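/- **Setting.** For every $N$ let $M=M(N)\in\mathbb N$ and put $d_N=N/M$; assume $\lim_{N\to\infty}d_N=d\in(0,\infty)$. For every $N$ let $Y=Y_N$ and $Z=Z_N$ be random $M\times N$ matrices with real or complex entries (no independence or moment assumption on the entries), on probability spaces with probabilities $\mathbb P^Y,\mathbb P^Z$ and expectations $\mathbb E^Y,\mathbb E^Z$. For a matrix $X\in\{Y,Z\}$ let $\lambda_1^X\ge\dots\ge\lambda_N^X$ be the eigenvalues of $X^\dagger X$, $G^X(z)=(X^\dagger X-z)^{-1}$ and $m^X(z)=\frac1N\operatorname{Tr}G^X(z)$. Let $\lambda_\pm=(1\pm\sqrt{d_N})^2$, $\varphi=(\log N)^{\log\log N}$, and for $\operatorname{Im}z>0$ $$m_c(z)=\frac{1-d_N-z+i\sqrt{(z-\lambda_-)(\lambda_+-z)}}{2d_Nz}$$ (principal square root), the Stieltjes transform of the Marchenko–Pastur law. For $a>0$ let $\mathbf S(a)$ be the set of $z=E+i\eta$ with $1_{d_N>1}\lambda_- /5\le E\le5\lambda_+$ and $\varphi^{a}N^{-1}\le\eta\le10(1+d_N)$. Events $A_N$ hold *with $\zeta$-high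 probability* if there is $C>0$ with $\mathbb P(A_N^c)\le N^C\exp(-\varphi^\zeta)$ for all large $N$. **Strong local law.** We say that $X$ satisfies the strong local law if for every $\zeta>0$ there is $C_\zeta>0$ such that each of the following holds with $\zeta$-high probability: (i) $|m^X(z)-m_c(z)|\le\varphi^{C_\zeta}\frac1{N\eta}$ for all $z\in\mathbf S(C_\zeta)$; (ii) $\max_{k\ne l}|G^X_{kl}(z)|+\max_k|G^X_{kk}(z)-m_c(z)|\le\varphi^{C_\zeta}\Big(\sqrt{\frac{\operatorname{Im}m_c(z)}{N\eta}}+\frac1{N\eta}\Big)$ for all $z\in\mathbf S(C_\zeta)$; (iii) $\lambda_--N^{-2/3}\varphi^{C_\zeta}\le\min_{j\le\min\{M,N\}}\lambda^X_j$ and $\max_{j}\lambda^X_j\le\lambda_++N^{-2/3}\varphi^{C_\zeta}$. **Green function comparison at an edge** $e\in\{\lambda_+,\lambda_-\}$. We say that $Y,Z$ satisfy it if (a) and (b) hold. (a) For every $C_1>0$ there are $\varepsilon_0>0$ and $C>0$ such that for every $0<\varepsilon<\varepsilon_0$ there is $N_0$ such that for all $N\ge N_0$, all $F\in C^4(\mathbb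 R,\mathbb R)$ with $|F^{(\alpha)}(x)|(|x|+1)^{-C_1}\le C_1$ for $\alpha=1,2,3,4$ and all $x$, and all real $E,E_1,E_2$ at distance at most $N^{-2/3+\varepsilon}$ from $e$, with $\eta=N^{-2/3-\varepsilon}$, $$\big|\mathbb E^YF\big(N\eta\operatorname{Im}m^Y(E+i\eta)\big)-\mathbb E^ZF\big(N\eta\operatorname{Im}m^Z(E+i\eta)\big)\big|\le CN^{-1/6+C\varepsilon},$$ $$\Big|\mathbb E^YF\Big(N\int_{E_1}^{E_2}\operatorname{Im}m^Y(y+i\eta)\,dy\Big)-\mathbb E^ZF\Big(N\int_{E_1}^{E_2}\operatorname{Im}m^Z(y+i\eta)\,dy\Big)\Big|\le CN^{-1/6+C\varepsilon}.$$ (b) For every $k\ge1$ and every bounded smooth $F:\mathbb R^k\to\mathbb R$ with bounded derivatives of all orders there is $\varepsilon_0>0$ such that for every $0<\varepsilon<\varepsilon_0$ there are $\delta>0$ and $N_0$ such that for all $N\ge N_0$ and all $E_k<\dots<E_1<E_0$ at distance at most $N^{-2/3+\varepsilon}$ from $e$, with $\eta=N^{-2/3-\varepsilon}$, $$\Big|\mathbb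 E^YF\Big(\Big(N\int_{E_j}^{E_0}\operatorname{Im}m^Y(y+i\eta)\,dy\Big)_{j=1}^k\Big)-\mathbb E^ZF\Big(\Big(N\int_{E_j}^{E_0}\operatorname{Im}m^Z(y+i\eta)\,dy\Big)_{j=1}^k\Big)\Big|\le N^{-\delta}.$$ **Theorem 4.5.** Let $Y$ and $Z$ both satisfy the strong local law. 1. If $Y,Z$ satisfy the Green function comparison at $\lambda_+$, then there are $\varepsilon>0$, $\delta>0$ and $N_0$ such that for all $N\ge N_0$ and all real $s$ $$\mathbb P^Y\big(N^{2/3}(\lambda_1^Y-\lambda_+)\le s-N^{-\varepsilon}\big)-N^{-\delta}\le\mathbb P^Z\big(N^{2/3}(\lambda_1^Z-\lambda_+)\le s\big)\le\mathbb P^Y\big(N^{2/3}(\lambda_1^Y-\lambda_+)\le s+N^{-\varepsilon}\big)+N^{-\delta}.$$ 2. If $d\ne1$ and $Y,Z$ satisfy the Green function comparison at $\lambda_-$, then the same holds with $\lambda_1^Y,\lambda_1^Z,\lambda_+$ replaced by $\lambda^Y_{\min\{M,N\}},\lambda^Z_{\min\{M,N\}},\lambda_-$. -/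

import Mathlib

open Filter Topology MeasureTheory
open scoped Matrix

/-- The control parameter `φ = (log N) ^ (log log N)`. -/
noncomputable def mpPhi (N : ℕ) : ℝ := Real.log N ^ Real.log (Real.log N)

/-- The upper spectral edge `λ₊ = (1 + √d)²`. -/
noncomputable def mpUpper (d : ℝ) : ℝ := (1 + Real.sqrt d) ^ 2

/-- The lower spectral edge `λ₋ = (1 - √d)²`. -/
noncomputable def mpLower (d : ℝ) : ℝ := (1 - Real.sqrt d) ^ 2

/-- The Stieltjes transform of the Marchenko-Pastur law with ratio `d = N / M`, on the upper half
plane: `m_c(z) = (1 - d - z + i √((z - λ₋)(λ₊ - z))) / (2 d z)`, where the square root has its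
branch cut along the negative real axis.  (For `d > 1` the law contains the atom of mass `1 - 1/d`
at `0` that is produced by the `N - M` trivial zero eigenvalues of `X†X`.) -/
noncomputable def mpStieltjes (d : ℝ) (z : ℂ) : ℂ :=
  (1 - (d : ℂ) - z
      + Complex.I * ((z - (mpLower d : ℂ)) * ((mpUpper d : ℂ) - z)) ^ (1 / 2 : ℂ))
    / (2 * (d : ℂ) * z)

/-- The spectral domain `S(a)`, for matrices with `N` columns and ratio `d`:
all `z = E + i η` with `1_{d>1} λ₋ / 5 ≤ E ≤ 5 λ₊` and `φ ^ a / N ≤ η ≤ 10 (1 + d)`. -/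
def mpDomain (N : ℕ) (d a : ℝ) : Set ℂ :=
  {z | (if 1 < d then mpLower d / 5 else 0) ≤ z.re ∧ z.re ≤ 5 * mpUpper d ∧
       mpPhi N ^ a * (N : ℝ)⁻¹ ≤ z.im ∧ z.im ≤ 10 * (1 + d)}

/-- The Green function `G(z) = (X†X - z)⁻¹`. -/
noncomputable def greenFn {m n : ℕ} (X : Matrix (Fin m) (Fin n) ℂ) (z : ℂ) :
    Matrix (Fin n) (Fin n) ℂ :=
  (Xᴴ * X - z • (1 : Matrix (Fin n) (Fin n) ℂ))⁻¹

/-- The empirical Stieltjes transform `m(z) = N⁻¹ Tr G(z)`. -/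
noncomputable def empStieltjes {m n : ℕ} (X : Matrix (Fin m) (Fin n) ℂ) (z : ℂ) : ℂ :=
  (n : ℂ)⁻¹ * (greenFn X z).trace

/-- The eigenvalues of `X†X`, repeated according to multiplicity, in decreasing order.  The count
starts at `0`: `covEig X 0` is `λ₁`, `covEig X (j - 1)` is `λ_j` for `1 ≤ j ≤ n`. -/
noncomputable def covEig {m n : ℕ} (X : Matrix (Fin m) (Fin n) ℂ) (j : ℕ) : ℝ :=
  if h : j < n then
    (Matrix.isHermitian_conjTranspose_mul_self X).eigenvalues₀ ⟨j, by simpa using h⟩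
  else 0

/-- `Λ = |m - m_c|`. -/
noncomputable def mpLambda {m n : ℕ} (d : ℝ) (X : Matrix (Fin m) (Fin n) ℂ) (z : ℂ) : ℝ :=
  ‖empStieltjes X z - mpStieltjes d z‖

/-- `Λ_d = max_k |G_kk - m_c|`. -/
noncomputable def mpLambdaDiag {m n : ℕ} (d : ℝ) (X : Matrix (Fin m) (Fin n) ℂ) (z : ℂ) : ℝ :=
  ⨆ k : Fin n, ‖greenFn X z k k - mpStieltjes d z‖

/-- `Λ_o = max_{k ≠ l} |G_kl|`. -/
noncomputable def mpLambdaOff {m n : ℕ} (X : Matrix (Fin m) (Fin n) ℂ) (z : ℂ) : ℝ :=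
  ⨆ p : {p : Fin n × Fin n // p.1 ≠ p.2}, ‖greenFn X z p.1.1 p.1.2‖

/-- The events `A N` hold with `ζ`-high probability: there is `C > 0` such that
`P(Aᶜ) ≤ N ^ C exp (- φ ^ ζ)` for all large enough `N`. -/
def HighProb {Ω : ℕ → Type*} [∀ N, MeasurableSpace (Ω N)] (P : ∀ N, Measure (Ω N)) (ζ : ℝ)
    (A : ∀ N, Set (Ω N)) : Prop :=
  ∃ C : ℝ, 0 < C ∧ ∀ᶠ N : ℕ in atTop,
    (P N).real (A N)ᶜ ≤ (N : ℝ) ^ C * Real.exp (-(mpPhi N ^ ζ))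

/-- Items (i), (ii), (iii) of the strong local Marchenko-Pastur law for a sequence of random
`M N × N` matrices `X N`, with `d N = N / M N`: for every `ζ > 0` there is `C = C_ζ` such that each
of the three events holds with `ζ`-high probability. -/
def StrongLocalMP {Ω : ℕ → Type*} [∀ N, MeasurableSpace (Ω N)] (P : ∀ N, Measure (Ω N))
    (M : ℕ → ℕ) (X : ∀ N, Ω N → Matrix (Fin (M N)) (Fin N) ℂ) : Prop :=
  ∀ ζ : ℝ, 0 < ζ → ∃ C : ℝ, 0 < C ∧
    -- (i) the empirical Stieltjes transform
    HighProb P ζ (fun N => {ω | ∀ z ∈ mpDomain N ((N : ℝ) / M N) C,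
      mpLambda ((N : ℝ) / M N) (X N ω) z ≤ mpPhi N ^ C * (1 / (N * z.im))}) ∧
    -- (ii) the matrix elements of the Green function
    HighProb P ζ (fun N => {ω | ∀ z ∈ mpDomain N ((N : ℝ) / M N) C,
      mpLambdaOff (X N ω) z + mpLambdaDiag ((N : ℝ) / M N) (X N ω) z ≤
        mpPhi N ^ C *
          (Real.sqrt ((mpStieltjes ((N : ℝ) / M N) z).im / (N * z.im)) + 1 / (N * z.im))}) ∧
    -- (iii) the smallest nontrivial and the largest eigenvalue
    HighProb P ζ (fun N => {ω |
      (∀ j < min (M N) N,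
        mpLower ((N : ℝ) / M N) - (N : ℝ) ^ (-(2 / 3) : ℝ) * mpPhi N ^ C ≤ covEig (X N ω) j) ∧
      (∀ j < N,
        covEig (X N ω) j ≤ mpUpper ((N : ℝ) / M N) + (N : ℝ) ^ (-(2 / 3) : ℝ) * mpPhi N ^ C)})

/-- The smoothed count `N ∫_a^b Im m(y + i η) dy`. -/
noncomputable def smoothCount {m n : ℕ} (X : Matrix (Fin m) (Fin n) ℂ) (η a b : ℝ) : ℝ :=
  (n : ℝ) * ∫ y in a..b, (empStieltjes X ((y : ℂ) + (η : ℂ) * Complex.I)).im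

/-- The conclusion of the Green function comparison theorem at the spectral edge `e N`, for two
sequences of random matrices `Y N` and `Z N`. -/
def GreenComparison {ΩY ΩZ : ℕ → Type*} [∀ N, MeasurableSpace (ΩY N)]
    [∀ N, MeasurableSpace (ΩZ N)] (PY : ∀ N, Measure (ΩY N)) (PZ : ∀ N, Measure (ΩZ N))
    (M : ℕ → ℕ) (Y : ∀ N, ΩY N → Matrix (Fin (M N)) (Fin N) ℂ)
    (Z : ∀ N, ΩZ N → Matrix (Fin (M N)) (Fin N) ℂ) (e : ℕ → ℝ) : Prop :=
  ∀ C₁ : ℝ, 0 < C₁ → ∃ ε₀ : ℝ, 0 < ε₀ ∧ ∃ C : ℝ, 0 < C ∧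
    ∀ ε : ℝ, 0 < ε → ε < ε₀ → ∃ N₀ : ℕ, ∀ N : ℕ, N₀ ≤ N →
    ∀ F : ℝ → ℝ, ContDiff ℝ 4 F →
      (∀ α : ℕ, 1 ≤ α → α ≤ 4 → ∀ x : ℝ,
        |iteratedDeriv α F x| * (|x| + 1) ^ (-C₁) ≤ C₁) →
    ∀ η : ℝ, η = (N : ℝ) ^ (-(2 / 3) - ε : ℝ) →
    ∀ E E₁ E₂ : ℝ,
      |E - e N| ≤ (N : ℝ) ^ (-(2 / 3) + ε : ℝ) →
      |E₁ - e N| ≤ (N : ℝ) ^ (-(2 / 3) + ε : ℝ) →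
      |E₂ - e N| ≤ (N : ℝ) ^ (-(2 / 3) + ε : ℝ) →
      |(∫ ω, F (N * η * (empStieltjes (Y N ω) ((E : ℂ) + (η : ℂ) * Complex.I)).im) ∂(PY N))
        - ∫ ω, F (N * η * (empStieltjes (Z N ω) ((E : ℂ) + (η : ℂ) * Complex.I)).im) ∂(PZ N)|
        ≤ C * (N : ℝ) ^ (-(1 / 6) + C * ε : ℝ) ∧
      |(∫ ω, F (smoothCount (Y N ω) η E₁ E₂) ∂(PY N))
        - ∫ ω, F (smoothCount (Z N ω) η E₁ E₂) ∂(PZ N)|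
        ≤ C * (N : ℝ) ^ (-(1 / 6) + C * ε : ℝ)

/-- The conclusion of the multi-point Green function comparison theorem at the spectral edge `e N`,
for bounded smooth functions of `k` variables all of whose derivatives are bounded. -/
def MultiGreenComparison {ΩY ΩZ : ℕ → Type*} [∀ N, MeasurableSpace (ΩY N)]
    [∀ N, MeasurableSpace (ΩZ N)] (PY : ∀ N, Measure (ΩY N)) (PZ : ∀ N, Measure (ΩZ N))
    (M : ℕ → ℕ) (Y : ∀ N, ΩY N → Matrix (Fin (M N)) (Fin N) ℂ)
    (Z : ∀ N, ΩZ N → Matrix (Fin (M N)) (Fin N) ℂ) (e : ℕ → ℝ) : Prop :=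
  ∀ k : ℕ, 1 ≤ k → ∀ F : (Fin k → ℝ) → ℝ, ContDiff ℝ ((⊤ : ℕ∞) : WithTop ℕ∞) F →
    (∀ r : ℕ, ∃ B : ℝ, ∀ x, ‖iteratedFDeriv ℝ r F x‖ ≤ B) →
    ∃ ε₀ : ℝ, 0 < ε₀ ∧ ∀ ε : ℝ, 0 < ε → ε < ε₀ →
    ∃ δ : ℝ, 0 < δ ∧ ∃ N₀ : ℕ, ∀ N : ℕ, N₀ ≤ N →
    ∀ η : ℝ, η = (N : ℝ) ^ (-(2 / 3) - ε : ℝ) →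
    ∀ E : Fin (k + 1) → ℝ, StrictAnti E →
      (∀ j, |E j - e N| ≤ (N : ℝ) ^ (-(2 / 3) + ε : ℝ)) →
      |(∫ ω, F (fun j : Fin k => smoothCount (Y N ω) η (E j.succ) (E 0)) ∂(PY N))
        - ∫ ω, F (fun j : Fin k => smoothCount (Z N ω) η (E j.succ) (E 0)) ∂(PZ N)|
        ≤ (N : ℝ) ^ (-δ)

/-- The distribution functions of `N ^ (2/3) (μ - e N)`, for the eigenvalues `μ = eigY N` of the
first and `μ = eigZ N` of the second ensemble, agree up to a shift of the argument by `N ^ (-ε)` and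
an error `N ^ (-δ)`, uniformly in the argument `s`. -/
def EdgeUniversal {ΩY ΩZ : ℕ → Type*} [∀ N, MeasurableSpace (ΩY N)]
    [∀ N, MeasurableSpace (ΩZ N)] (PY : ∀ N, Measure (ΩY N)) (PZ : ∀ N, Measure (ΩZ N))
    (eigY : ∀ N, ΩY N → ℝ) (eigZ : ∀ N, ΩZ N → ℝ) (e : ℕ → ℝ) : Prop :=
  ∃ ε : ℝ, 0 < ε ∧ ∃ δ : ℝ, 0 < δ ∧ ∃ N₀ : ℕ, ∀ N : ℕ, N₀ ≤ N → ∀ s : ℝ,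
    (PY N).real {ω | (N : ℝ) ^ (2 / 3 : ℝ) * (eigY N ω - e N) ≤ s - (N : ℝ) ^ (-ε)}
        - (N : ℝ) ^ (-δ)
      ≤ (PZ N).real {ω | (N : ℝ) ^ (2 / 3 : ℝ) * (eigZ N ω - e N) ≤ s} ∧
    (PZ N).real {ω | (N : ℝ) ^ (2 / 3 : ℝ) * (eigZ N ω - e N) ≤ s}
      ≤ (PY N).real {ω | (N : ℝ) ^ (2 / 3 : ℝ) * (eigY N ω - e N) ≤ s + (N : ℝ) ^ (-ε)}
        + (N : ℝ) ^ (-δ)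

/-!
The eigenvalue next to an edge `e` is read off from smoothed counts
`N ∫ Im m(y + i η) dy = ∑ⱼ ∫ η / ((λⱼ - y)² + η²) dy` over windows between an energy `E` near `e` and
a point just outside the spectrum.  With `q = N ^ (-2/3)` and `u = N ^ (ε/32)`, the height of the
count is `η = q / u³²`, the resolution in `E` is `l = q / u⁴`, and everything happens within
`O(q u⁴)` of `e`.

An eigenvalue in the window, at distance at least `η` from its end points, contributes at least `1`
to the count (`one_le_smoothCount`).  If instead the spectrum keeps the distance `l` from the window,
then each Cauchy kernel of height `η` is at most `2 η / l` times the one of height `l`, so the count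
is governed by `Im m` at height `l`, which by the local law is close to its deterministic counterpart
`Im m_c = O(√(|y - e| + l))`; the count is then at most `1 / 2`
(`EdgeBounds.smoothCount_le_half`).  A smooth cutoff `F` of the count is therefore sandwiched between
the indicators of `λ ≤ E - l` and `λ ≤ E + l`, and the Green function comparison for the expectation
of `F` gives the comparison of the distribution functions (`Locates.cdf_le`).

This covers energies `E` within `2 q u⁴` of `e`.  For the others both distribution functions are
close to the same constant, because the extreme eigenvalue is within `q u⁴` of `e` with high
probability: the extremal part of the local law gives one side, and for the other side the spectrum
cannot leave a gap around `e`, since `Im m(e + i s) / s` would then be nearly independent of `s`,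
while the lower bound `Im m_c(e + i s) ≥ c √s` and the matching upper bound exclude this
(`EdgeBounds.exists_covEig_near`).

At the lower edge the hypothesis `d ≠ 1` keeps `e` away from `0`, hence away from the trivial zero
eigenvalues of `X†X`.
-/

/-! ### Spectral representation of the empirical Stieltjes transform -/

/-- The resolvent trace of a Hermitian matrix is the sum of `1 / (λ - z)` over its eigenvalues. -/
theorem trace_inv_sub_smul_one {ι : Type*} [Fintype ι] [DecidableEq ι] {A : Matrix ι ι ℂ}
    (hA : A.IsHermitian) {z : ℂ} (hz : z.im ≠ 0) :
    ((A - z • (1 : Matrix ι ι ℂ))⁻¹).trace = ∑ i, ((hA.eigenvalues i : ℂ) - z)⁻¹ := by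
  set φ := Unitary.conjStarAlgAut ℂ (Matrix ι ι ℂ) hA.eigenvectorUnitary with hφ
  have hne : ∀ i, (hA.eigenvalues i : ℂ) - z ≠ 0 := fun i h => hz <| by
    have := congrArg Complex.im h
    simpa using this
  have h1 : A - z • (1 : Matrix ι ι ℂ)
      = φ (Matrix.diagonal fun i => (hA.eigenvalues i : ℂ) - z) := by
    have h2 : (Matrix.diagonal fun i => (hA.eigenvalues i : ℂ) - z)
        = Matrix.diagonal (RCLike.ofReal ∘ hA.eigenvalues) - z • (1 : Matrix ι ι ℂ) := by
      rw [Matrix.smul_one_eq_diagonal, Matrix.diagonal_sub]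
      rfl
    rw [h2, map_sub, map_smul, map_one, ← hA.spectral_theorem]
  have h3 : (A - z • (1 : Matrix ι ι ℂ))⁻¹
      = φ (Matrix.diagonal fun i => ((hA.eigenvalues i : ℂ) - z)⁻¹) := by
    apply Matrix.inv_eq_right_inv
    rw [h1, ← map_mul, Matrix.diagonal_mul_diagonal]
    simp only [mul_inv_cancel₀ (hne _), Matrix.diagonal_one, map_one]
  rw [h3, hφ, Unitary.conjStarAlgAut_apply, Matrix.trace_mul_cycle, Unitary.coe_star_mul_self,
    one_mul, Matrix.trace_diagonal]

/-- Sums over the eigenvalues of `X†X` are sums over the ordered eigenvalues `covEig X j`. -/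
theorem sum_eigenvalues_eq_sum_covEig {β : Type*} [AddCommMonoid β] {m n : ℕ}
    (X : Matrix (Fin m) (Fin n) ℂ) (f : ℝ → β) :
    ∑ i, f ((Matrix.isHermitian_conjTranspose_mul_self X).eigenvalues i)
      = ∑ j ∈ Finset.range n, f (covEig X j) := by
  unfold Matrix.IsHermitian.eigenvalues
  rw [Equiv.sum_comp (Fintype.equivOfCardEq _).symm
    (fun k => f ((Matrix.isHermitian_conjTranspose_mul_self X).eigenvalues₀ k)),
    Finset.sum_range]
  refine Fintype.sum_equiv (finCongr (Fintype.card_fin n)) _ _ fun k => ?_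
  have hk : (k : ℕ) < n := by simpa using k.2
  simp [covEig, hk]

theorem exists_covEig_eq_eigenvalue {m n : ℕ} (X : Matrix (Fin m) (Fin n) ℂ) {j : ℕ} (hj : j < n) :
    ∃ i, (Matrix.isHermitian_conjTranspose_mul_self X).eigenvalues i = covEig X j := by
  refine ⟨(Fintype.equivOfCardEq (Fintype.card_fin _)) ⟨j, by simpa using hj⟩, ?_⟩
  simp [covEig, hj, Matrix.IsHermitian.eigenvalues]

theorem covEig_nonneg {m n : ℕ} (X : Matrix (Fin m) (Fin n) ℂ) (j : ℕ) : 0 ≤ covEig X j := by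
  by_cases hj : j < n
  · obtain ⟨i, hi⟩ := exists_covEig_eq_eigenvalue X hj
    rw [← hi]
    exact Matrix.eigenvalues_conjTranspose_mul_self_nonneg X i
  · simp [covEig, hj]

theorem covEig_antitone {m n : ℕ} (X : Matrix (Fin m) (Fin n) ℂ) : Antitone (covEig X) := by
  intro i j hij
  by_cases hj : j < n
  · have hi : i < n := lt_of_le_of_lt hij hj
    simp only [covEig, hi, hj, dif_pos]
    exact (Matrix.isHermitian_conjTranspose_mul_self X).eigenvalues₀_antitone hij
  · rw [show covEig X j = 0 by simp [covEig, hj]]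
    exact covEig_nonneg X i

/-- The eigenvalues of `X†X` beyond the number of rows of `X` vanish. -/
theorem covEig_eq_zero {m n : ℕ} (X : Matrix (Fin m) (Fin n) ℂ) {j : ℕ} (hj : m ≤ j) :
    covEig X j = 0 := by
  by_contra hne
  have hpos : 0 < covEig X j := lt_of_le_of_ne (covEig_nonneg X j) (Ne.symm hne)
  have hjn : j < n := by
    by_contra h
    exact hne (by simp [covEig, h])
  have hA := Matrix.isHermitian_conjTranspose_mul_self X
  have hrank : (Xᴴ * X).rank ≤ m := by
    exact (Matrix.rank_mul_le_right _ _).trans (by simpa using X.rank_le_height)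
  have hcard : (Xᴴ * X).rank = ∑ k ∈ Finset.range n, if covEig X k ≠ 0 then 1 else 0 := by
    rw [hA.rank_eq_card_non_zero_eigs, Fintype.card_subtype, Finset.card_filter]
    exact sum_eigenvalues_eq_sum_covEig X fun x => if x ≠ 0 then 1 else 0
  have hle : j + 1 ≤ (Xᴴ * X).rank := by
    rw [hcard]
    calc j + 1 = ∑ k ∈ Finset.range (j + 1), if covEig X k ≠ 0 then 1 else 0 := by
          rw [Finset.sum_congr rfl (g := fun _ => 1)]
          · simp
          · intro k hk
            have : covEig X j ≤ covEig X k :=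
              covEig_antitone X (Nat.lt_succ_iff.mp (Finset.mem_range.mp hk))
            rw [if_pos (hpos.trans_le this).ne']
      _ ≤ _ := Finset.sum_le_sum_of_subset (Finset.range_mono hjn)
  omega

/-- The imaginary part of the resolvent trace is a sum of Cauchy kernels at the eigenvalues. -/
theorem mul_im_empStieltjes {m n : ℕ} (X : Matrix (Fin m) (Fin n) ℂ) (y : ℝ) {s : ℝ} (hs : s ≠ 0) :
    (n : ℝ) * (empStieltjes X ((y : ℂ) + (s : ℂ) * Complex.I)).im
      = ∑ j ∈ Finset.range n, s / ((covEig X j - y) ^ 2 + s ^ 2) := by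
  rcases Nat.eq_zero_or_pos n with rfl | hn
  · simp
  have hz : ((y : ℂ) + (s : ℂ) * Complex.I).im ≠ 0 := by simpa using hs
  have him : ∀ x : ℝ, (((x : ℂ) - ((y : ℂ) + (s : ℂ) * Complex.I))⁻¹).im
      = s / ((x - y) ^ 2 + s ^ 2) := by
    intro x
    simp [Complex.inv_im, Complex.normSq_apply]
    ring
  unfold empStieltjes greenFn
  rw [trace_inv_sub_smul_one (Matrix.isHermitian_conjTranspose_mul_self X) hz,
    sum_eigenvalues_eq_sum_covEig X fun x => ((x : ℂ) - ((y : ℂ) + (s : ℂ) * Complex.I))⁻¹]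
  have hn' : (n : ℝ) ≠ 0 := by exact_mod_cast hn.ne'
  rw [← Complex.ofReal_natCast, ← Complex.ofReal_inv, Complex.im_ofReal_mul, Complex.im_sum,
    mul_inv_cancel_left₀ hn']
  exact Finset.sum_congr rfl fun j _ => him _

theorem measurable_smoothCount {Ω : Type*} [MeasurableSpace Ω] {m n : ℕ}
    {X : Ω → Matrix (Fin m) (Fin n) ℂ} (hX : ∀ i j, Measurable fun ω => X ω i j) (η a b : ℝ) :
    Measurable fun ω => smoothCount (X ω) η a b := by
  have hmeas : Measurable fun p : Ω × ℝ =>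
      (empStieltjes (X p.1) ((p.2 : ℂ) + (η : ℂ) * Complex.I)).im := by
    let A : (Fin m → Fin n → ℂ) × ℝ → Matrix (Fin n) (Fin n) ℂ := fun p =>
      (Matrix.of p.1)ᴴ * Matrix.of p.1
        - ((p.2 : ℂ) + (η : ℂ) * Complex.I) • (1 : Matrix (Fin n) (Fin n) ℂ)
    have hof : Continuous fun p : (Fin m → Fin n → ℂ) × ℝ =>
        (Matrix.of p.1 : Matrix (Fin m) (Fin n) ℂ) := continuous_fst
    have hA : Continuous A := by
      refine (hof.matrix_conjTranspose.matrix_mul hof).sub ?_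
      have hc : Continuous fun p : (Fin m → Fin n → ℂ) × ℝ =>
          (p.2 : ℂ) + (η : ℂ) * Complex.I :=
        (Complex.continuous_ofReal.comp continuous_snd).add continuous_const
      exact hc.smul continuous_const
    have hF : Measurable fun p => ((n : ℂ)⁻¹ * ((A p).det⁻¹ * (A p).adjugate.trace)).im :=
      Complex.measurable_im.comp (measurable_const.mul
        (hA.matrix_det.measurable.inv.mul hA.matrix_adjugate.matrix_trace.measurable))
    have hG : Measurable fun p : Ω × ℝ => ((fun i j => X p.1 i j, p.2) :
        (Fin m → Fin n → ℂ) × ℝ) := by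
      refine Measurable.prodMk ?_ measurable_snd
      exact measurable_pi_lambda _ fun i => measurable_pi_lambda _ fun j =>
        (hX i j).comp measurable_fst
    convert hF.comp hG using 2 with p
    simp only [empStieltjes, greenFn, Matrix.inv_def, Ring.inverse_eq_inv', Matrix.trace_smul,
      smul_eq_mul, Function.comp]
    rfl
  have hint : ∀ s : Set ℝ, Measurable fun ω => ∫ y in s,
      (empStieltjes (X ω) ((y : ℂ) + (η : ℂ) * Complex.I)).im := fun s =>
    (StronglyMeasurable.integral_prod_right (ν := volume.restrict s)
      (f := fun ω y => (empStieltjes (X ω) ((y : ℂ) + (η : ℂ) * Complex.I)).im)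
      hmeas.stronglyMeasurable).measurable
  unfold smoothCount intervalIntegral
  exact measurable_const.mul ((hint _).sub (hint _))

theorem continuous_im_empStieltjes {m n : ℕ} (X : Matrix (Fin m) (Fin n) ℂ) {η : ℝ} (hη : 0 < η) :
    Continuous fun y : ℝ =>
      (n : ℝ) * (empStieltjes X ((y : ℂ) + (η : ℂ) * Complex.I)).im := by
  simp only [fun y : ℝ => mul_im_empStieltjes X y hη.ne']
  refine continuous_finsetSum _ fun j _ => continuous_const.div (by fun_prop) fun y => ?_
  positivity

/-- An eigenvalue at distance at least `η` inside the window contributes at least `1` to the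
smoothed count. -/
theorem one_le_smoothCount {m n : ℕ} (X : Matrix (Fin m) (Fin n) ℂ) {η a b : ℝ} (hη : 0 < η)
    {j : ℕ} (hj : j < n) (ha : a + η ≤ covEig X j) (hb : covEig X j + η ≤ b) :
    1 ≤ smoothCount X η a b := by
  set x := covEig X j with hx
  have hcont := continuous_im_empStieltjes X hη
  have hnonneg : ∀ y : ℝ,
      0 ≤ (n : ℝ) * (empStieltjes X ((y : ℂ) + (η : ℂ) * Complex.I)).im := by
    intro y
    rw [mul_im_empStieltjes X y hη.ne']
    exact Finset.sum_nonneg fun k _ => by positivity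
  unfold smoothCount
  rw [← intervalIntegral.integral_const_mul]
  calc (1 : ℝ) = ∫ _ in (x - η)..(x + η), 1 / (2 * η) := by
        rw [intervalIntegral.integral_const, smul_eq_mul]
        field_simp
        ring
    _ ≤ ∫ y in (x - η)..(x + η),
          (n : ℝ) * (empStieltjes X ((y : ℂ) + (η : ℂ) * Complex.I)).im := by
        refine intervalIntegral.integral_mono_on (by linarith) (by simp)
          (hcont.intervalIntegrable _ _) fun y hy => ?_
        rw [mul_im_empStieltjes X y hη.ne']
        refine le_trans ?_ (Finset.single_le_sum (f := fun k => η / ((covEig X k - y) ^ 2 + η ^ 2))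
          (fun k _ => by positivity) (Finset.mem_range.mpr hj))
        rw [div_le_div_iff₀ (by positivity) (by positivity)]
        have : (x - y) ^ 2 ≤ η ^ 2 := sq_le_sq' (by linarith [hy.2]) (by linarith [hy.1])
        rw [← hx]
        linarith
    _ ≤ _ := intervalIntegral.integral_mono_interval (by linarith) (by linarith) (by linarith)
        (Eventually.of_forall hnonneg) (hcont.intervalIntegrable _ _)

/-- Away from the spectrum the resolvent trace at height `η` is controlled by the one at the larger
height `l`, because the Cauchy kernel is proportional to its height at distances above `l`. -/
theorem mul_im_empStieltjes_le_of_gap {m n : ℕ} (X : Matrix (Fin m) (Fin n) ℂ) {η l y : ℝ}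
    (hη : 0 < η) (hl : 0 < l) (hgap : ∀ j < n, l ≤ |covEig X j - y|) :
    (n : ℝ) * (empStieltjes X ((y : ℂ) + (η : ℂ) * Complex.I)).im
      ≤ 2 * (η / l) * ((n : ℝ) * (empStieltjes X ((y : ℂ) + (l : ℂ) * Complex.I)).im) := by
  rw [mul_im_empStieltjes X y hη.ne', mul_im_empStieltjes X y hl.ne', Finset.mul_sum]
  refine Finset.sum_le_sum fun j hj => ?_
  have h1 : l ^ 2 ≤ (covEig X j - y) ^ 2 := by
    rw [← sq_abs (covEig X j - y)]
    exact pow_le_pow_left₀ hl.le (hgap j (Finset.mem_range.mp hj)) 2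
  rw [show 2 * (η / l) * (l / ((covEig X j - y) ^ 2 + l ^ 2))
      = 2 * η / ((covEig X j - y) ^ 2 + l ^ 2) by field_simp,
    div_le_div_iff₀ (by positivity) (by positivity)]
  nlinarith [sq_nonneg η, mul_le_mul_of_nonneg_left h1 hη.le,
    mul_nonneg hη.le (sq_nonneg η)]

theorem smoothCount_le_of_gap {m n : ℕ} (X : Matrix (Fin m) (Fin n) ℂ) {η l a b B : ℝ}
    (hη : 0 < η) (hl : 0 < l) (hab : a ≤ b)
    (hgap : ∀ y ∈ Set.Icc a b, ∀ j < n, l ≤ |covEig X j - y|)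
    (hB : ∀ y ∈ Set.Icc a b,
      (n : ℝ) * (empStieltjes X ((y : ℂ) + (l : ℂ) * Complex.I)).im ≤ B) :
    smoothCount X η a b ≤ (b - a) * (2 * (η / l) * B) := by
  unfold smoothCount
  rw [← intervalIntegral.integral_const_mul]
  calc _ ≤ ∫ _ in a..b, 2 * (η / l) * B := by
        refine intervalIntegral.integral_mono_on hab
          ((continuous_im_empStieltjes X hη).intervalIntegrable _ _) (by simp) fun y hy => ?_
        exact (mul_im_empStieltjes_le_of_gap X hη hl (hgap y hy)).trans
          (mul_le_mul_of_nonneg_left (hB y hy) (by positivity))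
    _ = _ := by rw [intervalIntegral.integral_const, smul_eq_mul]

theorem smoothCount_nonneg {m n : ℕ} (X : Matrix (Fin m) (Fin n) ℂ) {η a b : ℝ} (hη : 0 < η)
    (hab : a ≤ b) : 0 ≤ smoothCount X η a b := by
  unfold smoothCount
  rw [← intervalIntegral.integral_const_mul]
  refine intervalIntegral.integral_nonneg hab fun y _ => ?_
  rw [mul_im_empStieltjes X y hη.ne']
  exact Finset.sum_nonneg fun k _ => by positivity

/-! ### Square-root behaviour of the Marchenko–Pastur transform at an edge -/

/-- `e` is one of the two spectral edges of the Marchenko–Pastur law of ratio `d`. -/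
def IsMPEdge (d e : ℝ) : Prop := e = mpUpper d ∨ e = mpLower d

theorem mpUpper_sub_mpLower {d : ℝ} : mpUpper d - mpLower d = 4 * Real.sqrt d := by
  unfold mpUpper mpLower; ring

/-- The quadratic polynomial under the root in `m_c`, expanded around an edge `e`.  The sign `σ` is
`-1` at the upper and `1` at the lower edge, and `4 √d` is the distance between the edges. -/
theorem IsMPEdge.quadratic {d e : ℝ} (h : IsMPEdge d e) :
    ∃ σ : ℝ, |σ| = 1 ∧ ∀ z : ℂ, (z - (mpLower d : ℂ)) * ((mpUpper d : ℂ) - z)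
      = (z - e) * (σ * (4 * Real.sqrt d : ℝ) - (z - e)) := by
  have hD : (mpUpper d : ℂ) = mpLower d + (4 * Real.sqrt d : ℝ) := by
    rw [← mpUpper_sub_mpLower]; push_cast; ring
  rcases h with rfl | rfl
  · refine ⟨-1, by simp, fun z => ?_⟩
    rw [hD]; push_cast; ring
  · refine ⟨1, by simp, fun z => ?_⟩
    rw [hD]; push_cast; ring

theorem im_mpStieltjes {d y s : ℝ} (hd : d ≠ 0) (hs : s ≠ 0) :
    (mpStieltjes d ((y : ℂ) + (s : ℂ) * Complex.I)).im
      = (-(1 - d) * s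
          + (y * ((((y : ℂ) + s * Complex.I - (mpLower d : ℂ))
              * ((mpUpper d : ℂ) - (y + s * Complex.I))) ^ (2⁻¹ : ℂ)).re
            + s * ((((y : ℂ) + s * Complex.I - (mpLower d : ℂ))
              * ((mpUpper d : ℂ) - (y + s * Complex.I))) ^ (2⁻¹ : ℂ)).im))
        / (2 * d * (y ^ 2 + s ^ 2)) := by
  unfold mpStieltjes
  rw [one_div]
  generalize (((y : ℂ) + s * Complex.I - (mpLower d : ℂ))
              * ((mpUpper d : ℂ) - (y + s * Complex.I))) ^ (2⁻¹ : ℂ) = r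
  have hys : y ^ 2 + s ^ 2 ≠ 0 := by positivity
  have hz : (2 * (d : ℂ) * ((y : ℂ) + s * Complex.I)) ≠ 0 := by
    refine mul_ne_zero (by simpa using hd) fun h => hs ?_
    simpa using congrArg Complex.im h
  have hns : Complex.normSq (2 * (d : ℂ) * ((y : ℂ) + s * Complex.I))
      = 4 * d ^ 2 * (y ^ 2 + s ^ 2) := by
    simp [Complex.normSq_apply]; ring
  rw [Complex.div_im, hns]
  simp
  field_simp
  ring

theorem IsMPEdge.le_upper {d e : ℝ} (h : IsMPEdge d e) : e ≤ mpUpper d := by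
  rcases h with rfl | rfl
  · exact le_rfl
  · linarith [mpUpper_sub_mpLower (d := d), Real.sqrt_nonneg d]

theorem IsMPEdge.lower_le {d e : ℝ} (h : IsMPEdge d e) : mpLower d ≤ e := by
  rcases h with rfl | rfl
  · linarith [mpUpper_sub_mpLower (d := d), Real.sqrt_nonneg d]
  · exact le_rfl

/-- The square-root upper bound on `Im m_c` near an edge. -/
theorem im_mpStieltjes_le {d₁ d₂ c₀ : ℝ} (hd₁ : 0 < d₁) (hd₂ : 0 < d₂) (hc₀ : 0 < c₀) :
    ∃ C : ℝ, 0 < C ∧ ∀ d e : ℝ, d₁ ≤ d → d ≤ d₂ → IsMPEdge d e → c₀ ≤ e →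
      ∀ y s : ℝ, |y - e| ≤ c₀ / 2 → 0 < s → |y - e| + s ≤ 1 →
        (mpStieltjes d ((y : ℂ) + (s : ℂ) * Complex.I)).im ≤ C * Real.sqrt (|y - e| + s) := by
  set A : ℝ := 4 * Real.sqrt d₂ + 1 with hA
  have hA0 : 0 < A := by positivity
  refine ⟨((1 + d₂) * (4 / c₀ ^ 2) + (4 / c₀) * Real.sqrt A) / (2 * d₁), by positivity, ?_⟩
  intro d e hd hd' he hce y s hy hs hk
  have hd0 : 0 < d := hd₁.trans_le hd
  obtain ⟨σ, hσ, hw⟩ := he.quadratic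
  rw [im_mpStieltjes hd0.ne' hs.ne', hw]
  set k := |y - e| + s with hkdef
  have hk0 : 0 < k := by positivity
  set w : ℂ := ((y : ℂ) + s * Complex.I - e) * (σ * (4 * Real.sqrt d : ℝ)
    - ((y : ℂ) + s * Complex.I - e)) with hwdef
  have hze : ‖(y : ℂ) + s * Complex.I - e‖ ≤ k := by
    have h1 : (y : ℂ) + s * Complex.I - e = ((y - e : ℝ) : ℂ) + (s : ℂ) * Complex.I := by
      push_cast; ring
    rw [h1]
    refine (norm_add_le _ _).trans ?_
    simp [hkdef, abs_of_pos hs, -Complex.ofReal_sub]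
  have hwk : ‖w‖ ≤ k * A := by
    rw [hwdef, norm_mul]
    refine mul_le_mul hze ((norm_sub_le _ _).trans (add_le_add ?_ (hze.trans hk)))
      (norm_nonneg _) hk0.le
    rw [norm_mul, Complex.norm_real, Complex.norm_real, Real.norm_eq_abs, hσ, one_mul,
      Real.norm_of_nonneg (by positivity)]
    gcongr
  have hr : ‖w ^ (2⁻¹ : ℂ)‖ ≤ Real.sqrt k * Real.sqrt A := by
    have h1 : ‖w ^ (2⁻¹ : ℂ)‖ = Real.sqrt ‖w‖ := by
      rw [Real.sqrt_eq_rpow, show (2⁻¹ : ℂ) = ((2⁻¹ : ℝ) : ℂ) by simp,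
        Complex.norm_cpow_real]
      norm_num
    rw [h1, ← Real.sqrt_mul hk0.le]
    exact Real.sqrt_le_sqrt hwk
  have hy0 : c₀ / 2 ≤ y := by linarith [(abs_le.mp hy).1]
  have hypos : 0 < y := by linarith
  have hsk : s ≤ Real.sqrt k := by
    refine Real.le_sqrt_of_sq_le ?_
    nlinarith [abs_nonneg (y - e)]
  have hQ : 0 < y ^ 2 + s ^ 2 := by positivity
  have h1 : 1 ≤ (4 / c₀ ^ 2) * (y ^ 2 + s ^ 2) := by
    rw [div_mul_eq_mul_div, le_div_iff₀ (by positivity)]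
    nlinarith [sq_nonneg s]
  have h2 : y + s ≤ (4 / c₀) * (y ^ 2 + s ^ 2) := by
    rw [div_mul_eq_mul_div, le_div_iff₀ hc₀]
    nlinarith [sq_nonneg (y - s), mul_le_mul_of_nonneg_left hy0 hypos.le,
      mul_le_mul_of_nonneg_left hy0 hs.le]
  rw [div_le_iff₀ (by positivity)]
  have h3 : -(1 - d) * s ≤ (1 + d₂) * Real.sqrt k := by
    refine mul_le_mul (by linarith) hsk hs.le (by linarith)
  have h4 : y * (w ^ (2⁻¹ : ℂ)).re + s * (w ^ (2⁻¹ : ℂ)).im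
      ≤ (y + s) * (Real.sqrt k * Real.sqrt A) := by
    rw [add_mul]
    exact add_le_add
      (mul_le_mul_of_nonneg_left ((Complex.re_le_norm _).trans hr) hypos.le)
      (mul_le_mul_of_nonneg_left ((Complex.im_le_norm _).trans hr) hs.le)
  have h5 : (1 + d₂) * Real.sqrt k ≤ (1 + d₂) * Real.sqrt k * ((4 / c₀ ^ 2) * (y ^ 2 + s ^ 2)) :=
    le_mul_of_one_le_right (by positivity) h1
  have h6 : (y + s) * (Real.sqrt k * Real.sqrt A)
      ≤ (4 / c₀) * (y ^ 2 + s ^ 2) * (Real.sqrt k * Real.sqrt A) := by gcongr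
  set T := ((1 + d₂) * (4 / c₀ ^ 2) + (4 / c₀) * Real.sqrt A) * (Real.sqrt k * (y ^ 2 + s ^ 2))
    with hT
  have hT0 : 0 ≤ T := by positivity
  have h7 : T ≤ T * (d / d₁) := le_mul_of_one_le_right hT0 ((one_le_div hd₁).mpr hd)
  have h8 : ((1 + d₂) * (4 / c₀ ^ 2) + 4 / c₀ * Real.sqrt A) / (2 * d₁) * Real.sqrt k
      * (2 * d * (y ^ 2 + s ^ 2)) = T * (d / d₁) := by
    rw [hT]; field_simp
  rw [h8]
  refine le_trans ?_ h7
  rw [hT]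
  nlinarith [h3, h4, h5, h6]

/-- The square-root lower bound on `Im m_c` above an edge. -/
theorem le_im_mpStieltjes {d₁ d₂ c₀ : ℝ} (hd₁ : 0 < d₁) (hd₂ : 0 < d₂) (hc₀ : 0 < c₀) :
    ∃ c : ℝ, 0 < c ∧ ∃ r : ℝ, 0 < r ∧ ∀ d e : ℝ, d₁ ≤ d → d ≤ d₂ → IsMPEdge d e → c₀ ≤ e →
      ∀ s : ℝ, 0 < s → s ≤ r →
        c * Real.sqrt s ≤ (mpStieltjes d ((e : ℂ) + (s : ℂ) * Complex.I)).im := by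
  set K : ℝ := Real.sqrt (2 * Real.sqrt d₁) with hK
  have hK0 : 0 < K := by positivity
  have hU : 0 < mpUpper d₂ := by unfold mpUpper; positivity
  refine ⟨K / (16 * d₂ * mpUpper d₂), by positivity,
    min (c₀ / 2) ((c₀ / 4 * K) ^ 2), by positivity, ?_⟩
  intro d e hd hd' he hce s hs hsr
  have hd0 : 0 < d := hd₁.trans_le hd
  have he0 : 0 < e := hc₀.trans_le hce
  obtain ⟨σ, hσ, hw⟩ := he.quadratic
  rw [im_mpStieltjes hd0.ne' hs.ne', hw]
  have hs1 : s ≤ c₀ / 2 := hsr.trans (min_le_left _ _)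
  have hs2 : Real.sqrt s ≤ c₀ / 4 * K := by
    rw [Real.sqrt_le_left (by positivity)]
    exact hsr.trans (min_le_right _ _)
  set w : ℂ := ((e : ℂ) + s * Complex.I - e) * (σ * (4 * Real.sqrt d : ℝ)
    - ((e : ℂ) + s * Complex.I - e)) with hwdef
  have hre : w.re = s ^ 2 := by simp [hwdef]; ring
  have him : w.im = s * (σ * (4 * Real.sqrt d)) := by simp [hwdef]
  have hnorm : 4 * Real.sqrt d₁ * s ≤ ‖w‖ := by
    refine le_trans ?_ (Complex.abs_im_le_norm w)
    rw [him, abs_mul, abs_mul, hσ, abs_of_pos hs, abs_of_nonneg (by positivity), one_mul, mul_comm]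
    gcongr
  set r := w ^ (2⁻¹ : ℂ) with hr
  have hre_r : r.re = Real.sqrt ((‖w‖ + w.re) / 2) := Complex.cpow_inv_two_re w
  have him_r : |r.im| ≤ r.re := by
    rw [hre_r, hr, Complex.abs_cpow_inv_two_im, hre]
    exact Real.sqrt_le_sqrt (by nlinarith [sq_nonneg s])
  have hre_low : K * Real.sqrt s ≤ r.re := by
    rw [hre_r, hK, ← Real.sqrt_mul (by positivity), hre]
    exact Real.sqrt_le_sqrt (by nlinarith [sq_nonneg s])
  have hU' : e ≤ mpUpper d₂ := he.le_upper.trans (by unfold mpUpper; gcongr)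
  have hss : Real.sqrt s * Real.sqrt s = s := Real.mul_self_sqrt hs.le
  have hs0 : 0 < Real.sqrt s := Real.sqrt_pos.mpr hs
  have h1 : e / 2 * (K * Real.sqrt s) ≤ e * r.re + s * r.im := by
    have : -r.re ≤ r.im := (abs_le.mp him_r).1
    have hrr : 0 ≤ r.re := (abs_nonneg _).trans him_r
    nlinarith [mul_le_mul_of_nonneg_left this hs.le, mul_le_mul_of_nonneg_left hre_low he0.le,
      mul_le_mul_of_nonneg_right (hs1.trans (by linarith : c₀ / 2 ≤ e / 2)) hrr]
  have h2 : s ≤ e / 4 * (K * Real.sqrt s) := by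
    calc s = Real.sqrt s * Real.sqrt s := hss.symm
      _ ≤ c₀ / 4 * K * Real.sqrt s := by gcongr
      _ ≤ e / 4 * K * Real.sqrt s := by gcongr
      _ = _ := by ring
  have h3 : e / 4 * (K * Real.sqrt s)
      ≤ -(1 - d) * s + (e * r.re + s * r.im) := by
    nlinarith [mul_pos hd0 hs]
  rw [le_div_iff₀ (by positivity)]
  refine le_trans ?_ h3
  have h4 : d * (e ^ 2 + s ^ 2) ≤ d₂ * (2 * (mpUpper d₂ * e)) := by
    refine mul_le_mul hd' ?_ (by positivity) hd₂.le
    nlinarith [mul_le_mul_of_nonneg_right hU' he0.le]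
  calc K / (16 * d₂ * mpUpper d₂) * Real.sqrt s * (2 * d * (e ^ 2 + s ^ 2))
      = K / (8 * d₂ * mpUpper d₂) * Real.sqrt s * (d * (e ^ 2 + s ^ 2)) := by
        field_simp; ring
    _ ≤ K / (8 * d₂ * mpUpper d₂) * Real.sqrt s * (d₂ * (2 * (mpUpper d₂ * e))) := by gcongr
    _ = e / 4 * (K * Real.sqrt s) := by field_simp; ring

/-! ### Eigenvalue locations from square-root bounds at an edge -/

/-- Square-root bounds near the energy `e` on the resolvent trace of `X†X`: at distances and heights
up to `3 q u⁴` and between `q / u⁴` and `q u⁴` respectively, `Im m` is at most `C √(|y - e| + s)`,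
and at `e` itself at least `c √s`, up to the error `u² / (n s)`.  Here `q` stands for the scale
`n ^ (-2/3)` of edge fluctuations and `u` for a small positive power of `n`. -/
structure EdgeBounds {m n : ℕ} (X : Matrix (Fin m) (Fin n) ℂ) (e q u c C : ℝ) : Prop where
  upper : ∀ y s : ℝ, |y - e| ≤ 3 * (q * u ^ 4) → q / u ^ 4 ≤ s → s ≤ q * u ^ 4 →
    (n : ℝ) * (empStieltjes X ((y : ℂ) + (s : ℂ) * Complex.I)).im
      ≤ n * (C * Real.sqrt (|y - e| + s)) + u ^ 2 / s
  lower : ∀ s : ℝ, q / u ^ 4 ≤ s → s ≤ q * u ^ 4 →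
    n * (c * Real.sqrt s) - u ^ 2 / s
      ≤ (n : ℝ) * (empStieltjes X ((e : ℂ) + (s : ℂ) * Complex.I)).im

theorem sqrt_mul_pow_four {q u : ℝ} (hq : 0 < q) :
    Real.sqrt (q * u ^ 4) = Real.sqrt q * u ^ 2 := by
  rw [Real.sqrt_mul hq.le, show u ^ 4 = (u ^ 2) ^ 2 by ring, Real.sqrt_sq (by positivity)]

/-- Some eigenvalue lies within `q u⁴` of the edge.  Otherwise `Im m(e + i s) / s` would be
essentially the same at the heights `s = q u²` and `s = q u⁴`, whereas `c √s ≲ Im m(e + i s) ≲ C √s`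
forces the two values to differ by a factor of order `u`. -/
theorem EdgeBounds.exists_covEig_near {m n : ℕ} {X : Matrix (Fin m) (Fin n) ℂ} {e q u c C : ℝ}
    (h : EdgeBounds X e q u c C) (hq : 0 < q) (hu : 1 ≤ u) (hn : (n : ℝ) * (q * Real.sqrt q) = 1)
    (hlarge : 2 * C + 3 < c * u) :
    ∃ j < n, |covEig X j - e| < q * u ^ 4 := by
  by_contra! hcon
  have hu0 : 0 < u := by linarith
  have hnq : (n : ℝ) * Real.sqrt q = 1 / q := by
    field_simp
    linarith
  have hle : ∀ k : ℕ, 1 ≤ u ^ k := fun k => one_le_pow₀ hu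
  have h1 := h.lower (q * u ^ 2)
    ((div_le_self hq.le (hle 4)).trans (le_mul_of_one_le_right hq.le (hle 2)))
    (by gcongr; norm_num)
  have h2 := h.upper e (q * u ^ 4) (by rw [sub_self, abs_zero]; positivity)
    ((div_le_self hq.le (hle 4)).trans (le_mul_of_one_le_right hq.le (hle 4))) le_rfl
  have h3 := mul_im_empStieltjes_le_of_gap X (η := q * u ^ 2) (l := q * u ^ 4) (y := e)
    (by positivity) (by positivity) hcon
  rw [sub_self, abs_zero, zero_add, sqrt_mul_pow_four hq] at h2
  have hs : Real.sqrt (q * u ^ 2) = Real.sqrt q * u := by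
    rw [Real.sqrt_mul hq.le, Real.sqrt_sq hu0.le]
  rw [hs] at h1
  have h4 := h1.trans (h3.trans (mul_le_mul_of_nonneg_left h2 (by positivity)))
  have e1 : (n : ℝ) * (c * (Real.sqrt q * u)) - u ^ 2 / (q * u ^ 2) = (c * u - 1) / q := by
    rw [show (n : ℝ) * (c * (Real.sqrt q * u)) = (n * Real.sqrt q) * (c * u) by ring, hnq]
    field_simp
  have e2 : 2 * (q * u ^ 2 / (q * u ^ 4))
      * ((n : ℝ) * (C * (Real.sqrt q * u ^ 2)) + u ^ 2 / (q * u ^ 4))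
      = (2 * C + 2 / u ^ 4) / q := by
    rw [show (n : ℝ) * (C * (Real.sqrt q * u ^ 2)) = (n * Real.sqrt q) * (C * u ^ 2) by ring, hnq]
    field_simp
  rw [e1, e2, div_le_div_iff_of_pos_right hq] at h4
  have h5 : 2 / u ^ 4 ≤ 2 := div_le_self (by norm_num) (hle 4)
  linarith

/-- A window near the edge at distance at least `q / u⁴` from the spectrum has a small smoothed
count at the height `q / u³²`. -/
theorem EdgeBounds.smoothCount_le_half {m n : ℕ} {X : Matrix (Fin m) (Fin n) ℂ}
    {e q u c C a b : ℝ} (h : EdgeBounds X e q u c C) (hC : 0 < C) (hq : 0 < q) (hu : 1 ≤ u)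
    (hn : (n : ℝ) * (q * Real.sqrt q) = 1) (hlarge : 24 * (2 * C + 1) ≤ u) (hab : a ≤ b)
    (ha : e - 3 * (q * u ^ 4) ≤ a) (hb : b ≤ e + 3 * (q * u ^ 4))
    (hgap : ∀ y ∈ Set.Icc a b, ∀ j < n, q / u ^ 4 ≤ |covEig X j - y|) :
    smoothCount X (q / u ^ 32) a b ≤ 1 / 2 := by
  have hu0 : 0 < u := by linarith
  have hnq : (n : ℝ) * Real.sqrt q = 1 / q := by
    field_simp
    linarith
  have hle : ∀ k : ℕ, 1 ≤ u ^ k := fun k => one_le_pow₀ hu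
  have hl4 : q / u ^ 4 ≤ q * u ^ 4 :=
    (div_le_self hq.le (hle 4)).trans (le_mul_of_one_le_right hq.le (hle 4))
  refine (smoothCount_le_of_gap X (l := q / u ^ 4) (B := (2 * C * u ^ 2 + u ^ 6) / q)
    (by positivity) (by positivity) hab hgap ?_).trans ?_
  · intro y hy
    have hy' : |y - e| ≤ 3 * (q * u ^ 4) :=
      abs_le.mpr ⟨by linarith [hy.1], by linarith [hy.2]⟩
    refine (h.upper y _ hy' le_rfl hl4).trans ?_
    have h1 : Real.sqrt (|y - e| + q / u ^ 4) ≤ 2 * (Real.sqrt q * u ^ 2) := by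
      rw [← sqrt_mul_pow_four hq, show (2 : ℝ) = Real.sqrt 4 by
        rw [show (4 : ℝ) = 2 ^ 2 by norm_num, Real.sqrt_sq (by norm_num)],
        ← Real.sqrt_mul (by norm_num)]
      exact Real.sqrt_le_sqrt (by linarith)
    calc (n : ℝ) * (C * Real.sqrt (|y - e| + q / u ^ 4)) + u ^ 2 / (q / u ^ 4)
        ≤ n * (C * (2 * (Real.sqrt q * u ^ 2))) + u ^ 2 / (q / u ^ 4) := by gcongr
      _ = (n * Real.sqrt q) * (2 * C * u ^ 2) + u ^ 2 / (q / u ^ 4) := by ring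
      _ = _ := by rw [hnq]; field_simp
  · calc (b - a) * (2 * (q / u ^ 32 / (q / u ^ 4)) * ((2 * C * u ^ 2 + u ^ 6) / q))
        ≤ (6 * (q * u ^ 4)) * (2 * (q / u ^ 32 / (q / u ^ 4)) * ((2 * C * u ^ 2 + u ^ 6) / q)) := by
          gcongr
          linarith
      _ ≤ (6 * (q * u ^ 4)) * (2 * (q / u ^ 32 / (q / u ^ 4)) * ((2 * C * u ^ 6 + u ^ 6) / q)) := by
          gcongr; norm_num
      _ = 12 * (2 * C + 1) / u ^ 18 := by field_simp; ring
      _ ≤ 12 * (2 * C + 1) / u := by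
          gcongr
          exact le_self_pow₀ hu (by norm_num)
      _ ≤ 1 / 2 := by
          rw [div_le_div_iff₀ hu0 (by norm_num)]
          linarith

/-- The smoothed count above `E` decides on which side of `E` the largest eigenvalue lies. -/
theorem EdgeBounds.locate_largest {m n : ℕ} {X : Matrix (Fin m) (Fin n) ℂ}
    {e q u c C : ℝ} (h : EdgeBounds X e q u c C) (hC : 0 < C) (hq : 0 < q) (hu : 1 ≤ u)
    (hn : (n : ℝ) * (q * Real.sqrt q) = 1) (hlarge : 24 * (2 * C + 1) ≤ u)
    (hlarge' : 2 * C + 3 < c * u) (hmax : ∀ j < n, covEig X j ≤ e + q * u ^ 2) :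
    |covEig X 0 - e| ≤ q * u ^ 4 ∧ ∀ E : ℝ, |E - e| ≤ 2 * (q * u ^ 4) →
      (covEig X 0 ≤ E - q / u ^ 4 →
        smoothCount X (q / u ^ 32) E (e + 3 * (q * u ^ 4)) ≤ 1 / 2) ∧
      (E + q / u ^ 4 < covEig X 0 →
        1 ≤ smoothCount X (q / u ^ 32) E (e + 3 * (q * u ^ 4))) := by
  have hu0 : 0 < u := by linarith
  obtain ⟨j, hj, hje⟩ := h.exists_covEig_near hq hu hn hlarge'
  have hn0 : 0 < n := (Nat.zero_le j).trans_lt hj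
  have hq4 : q ≤ q * u ^ 4 := le_mul_of_one_le_right hq.le (one_le_pow₀ hu)
  have h24 : q * u ^ 2 ≤ q * u ^ 4 := by gcongr; norm_num
  have hη : q / u ^ 32 ≤ q / u ^ 4 := by gcongr; norm_num
  have hηq : q / u ^ 32 ≤ q := div_le_self hq.le (one_le_pow₀ hu)
  have hη0 : 0 < q / u ^ 32 := by positivity
  have h0 := hmax 0 hn0
  have hj0 := covEig_antitone X (Nat.zero_le j)
  refine ⟨abs_le.mpr ⟨by linarith [(abs_lt.mp hje).1], by linarith⟩, fun E hE => ⟨?_, ?_⟩⟩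
  · intro hμ
    refine h.smoothCount_le_half hC hq hu hn hlarge (by linarith [(abs_le.mp hE).2])
      (by linarith [(abs_le.mp hE).1]) le_rfl fun y hy i _ => ?_
    rw [abs_sub_comm]
    refine le_trans ?_ (le_abs_self _)
    linarith [hy.1, covEig_antitone X (Nat.zero_le i)]
  · intro hμ
    exact one_le_smoothCount X hη0 hn0 (by linarith) (by linarith)

/-- The smoothed count below `E` decides on which side of `E` the smallest nontrivial eigenvalue
lies.  The trivial zero eigenvalues stay away from the window, because `e` is bounded below. -/
theorem EdgeBounds.locate_smallest {m n : ℕ} {X : Matrix (Fin m) (Fin n) ℂ}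
    {e q u c C : ℝ} (h : EdgeBounds X e q u c C) (hC : 0 < C) (hq : 0 < q) (hu : 1 ≤ u)
    (hn : (n : ℝ) * (q * Real.sqrt q) = 1) (hlarge : 24 * (2 * C + 1) ≤ u)
    (hlarge' : 2 * C + 3 < c * u) (he : 4 * (q * u ^ 4) ≤ e)
    (hmin : ∀ j < min m n, e - q * u ^ 2 ≤ covEig X j) :
    |covEig X (min m n - 1) - e| ≤ q * u ^ 4 ∧ ∀ E : ℝ, |E - e| ≤ 2 * (q * u ^ 4) →
      (covEig X (min m n - 1) ≤ E - q / u ^ 4 →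
        1 ≤ smoothCount X (q / u ^ 32) (e - 3 * (q * u ^ 4)) E) ∧
      (E + q / u ^ 4 < covEig X (min m n - 1) →
        smoothCount X (q / u ^ 32) (e - 3 * (q * u ^ 4)) E ≤ 1 / 2) := by
  have hu0 : 0 < u := by linarith
  obtain ⟨j, hj, hje⟩ := h.exists_covEig_near hq hu hn hlarge'
  have hq4 : q ≤ q * u ^ 4 := le_mul_of_one_le_right hq.le (one_le_pow₀ hu)
  have hl : q / u ^ 4 ≤ q := div_le_self hq.le (one_le_pow₀ hu)
  have h24 : q * u ^ 2 ≤ q * u ^ 4 := by gcongr; norm_num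
  have hη : q / u ^ 32 ≤ q / u ^ 4 := by gcongr; norm_num
  have hη0 : 0 < q / u ^ 32 := by positivity
  have hjm : j < m := by
    by_contra hjm
    rw [covEig_eq_zero X (not_lt.mp hjm)] at hje
    linarith [(abs_lt.mp hje).1]
  have hmn : min m n - 1 < min m n := by omega
  have h0 := hmin _ hmn
  have hj0 : covEig X (min m n - 1) ≤ covEig X j := covEig_antitone X (by omega)
  refine ⟨abs_le.mpr ⟨by linarith, by linarith [(abs_lt.mp hje).2]⟩, fun E hE => ⟨?_, ?_⟩⟩
  · intro hμ
    exact one_le_smoothCount X hη0 (by omega : min m n - 1 < n) (by linarith) (by linarith)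
  · intro hμ
    refine h.smoothCount_le_half hC hq hu hn hlarge (by linarith [(abs_le.mp hE).1])
      le_rfl (by linarith [(abs_le.mp hE).2]) fun y hy i hi => ?_
    by_cases him : i < m
    · refine le_trans ?_ (le_abs_self _)
      have : covEig X (min m n - 1) ≤ covEig X i := covEig_antitone X (by omega)
      linarith [hy.2]
    · rw [covEig_eq_zero X (not_lt.mp him), abs_sub_comm]
      refine le_trans ?_ (le_abs_self _)
      linarith [hy.1]

/-! ### From test functions to distribution functions -/

/-- Outside an event of probability at most `p`, the random variable `μ` is within `ρ` of `e`, and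
for every `E` within `2ρ` of `e` the test function `g E` is `1` where `μ ≤ E - l` and `0` where
`E + l < μ`. -/
def Locates {Ω : Type*} [MeasurableSpace Ω] (P : Measure Ω) (μ : Ω → ℝ) (e ρ l p : ℝ)
    (g : ℝ → Ω → ℝ) : Prop :=
  ∃ G : Set Ω, P.real Gᶜ ≤ p ∧ ∀ ω ∈ G, |μ ω - e| ≤ ρ ∧ ∀ E : ℝ, |E - e| ≤ 2 * ρ →
    (μ ω ≤ E - l → g E ω = 1) ∧ (E + l < μ ω → g E ω = 0)

/-- Distribution functions of two random variables located by test functions with close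
expectations are close, up to a shift by `2l`. -/
theorem Locates.cdf_le {Ω Ω' : Type*} [MeasurableSpace Ω] [MeasurableSpace Ω']
    {P : Measure Ω} {P' : Measure Ω'} [IsProbabilityMeasure P] [IsProbabilityMeasure P']
    {μ : Ω → ℝ} {μ' : Ω' → ℝ} {e ρ l p κ : ℝ} {g : ℝ → Ω → ℝ} {g' : ℝ → Ω' → ℝ}
    (h : Locates P μ e ρ l p g) (h' : Locates P' μ' e ρ l p g')
    (hg : ∀ E, Measurable (g E)) (hg' : ∀ E, Measurable (g' E))
    (hg01 : ∀ E ω, g E ω ∈ Set.Icc (0 : ℝ) 1) (hg01' : ∀ E ω, g' E ω ∈ Set.Icc (0 : ℝ) 1)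
    (hρ : 0 ≤ ρ) (hl : 0 ≤ l) (hκ : 0 ≤ κ)
    (hclose : ∀ E, |E - e| ≤ 2 * ρ → |(∫ ω, g E ω ∂P) - ∫ ω, g' E ω ∂P'| ≤ κ) (E : ℝ) :
    P.real {ω | μ ω ≤ E - 2 * l} ≤ P'.real {ω | μ' ω ≤ E} + (2 * p + κ) := by
  obtain ⟨G, hGp, hG⟩ := h
  obtain ⟨G', hGp', hG'⟩ := h'
  have hp : 0 ≤ p := measureReal_nonneg.trans hGp
  have hpos : 0 ≤ P'.real {ω | μ' ω ≤ E} := measureReal_nonneg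
  by_cases hE : |E - l - e| ≤ 2 * ρ
  · have hint : Integrable (g (E - l)) P := Integrable.of_mem_Icc 0 1 (hg _).aemeasurable
      (Eventually.of_forall (hg01 _))
    have hint' : Integrable (g' (E - l)) P' := Integrable.of_mem_Icc 0 1 (hg' _).aemeasurable
      (Eventually.of_forall (hg01' _))
    have h1 : P.real {ω | μ ω ≤ E - 2 * l} ≤ (∫ ω, g (E - l) ω ∂P) + p := by
      have hsub : {ω | μ ω ≤ E - 2 * l} ⊆ {ω | 1 ≤ g (E - l) ω} ∪ Gᶜ := by
        intro ω hω
        by_cases hωG : ω ∈ G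
        · left
          have hω' : μ ω ≤ E - 2 * l := hω
          exact (((hG ω hωG).2 _ hE).1 (by linarith)).ge
        · exact Or.inr hωG
      refine (measureReal_mono hsub).trans ((measureReal_union_le _ _).trans (add_le_add ?_ hGp))
      have := mul_meas_ge_le_integral_of_nonneg
        (Eventually.of_forall fun ω => (hg01 (E - l) ω).1) hint 1
      simpa using this
    have h2 : (∫ ω, g' (E - l) ω ∂P') ≤ P'.real {ω | μ' ω ≤ E} + p := by
      have hms : MeasurableSet {ω | 0 < g' (E - l) ω} := measurableSet_lt measurable_const (hg' _)
      have hsub : {ω | 0 < g' (E - l) ω} ⊆ {ω | μ' ω ≤ E} ∪ G'ᶜ := by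
        intro ω hω
        by_cases hωG : ω ∈ G'
        · left
          by_contra hlt
          have hlt' : E < μ' ω := not_le.mp hlt
          have := ((hG' ω hωG).2 _ hE).2 (by linarith)
          exact (ne_of_gt hω) this
        · exact Or.inr hωG
      calc (∫ ω, g' (E - l) ω ∂P')
          ≤ ∫ ω, {ω | 0 < g' (E - l) ω}.indicator (fun _ => (1 : ℝ)) ω ∂P' := by
            refine integral_mono hint' ((integrable_const _).indicator hms) fun ω => ?_
            by_cases hω : 0 < g' (E - l) ω
            · rw [Set.indicator_of_mem (by exact hω)]
              exact (hg01' _ ω).2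
            · rw [Set.indicator_of_notMem (by exact hω)]
              exact not_lt.mp hω
        _ = P'.real {ω | 0 < g' (E - l) ω} := by
            rw [integral_indicator_const _ hms, smul_eq_mul, mul_one]
        _ ≤ _ := (measureReal_mono hsub).trans
            ((measureReal_union_le _ _).trans (add_le_add le_rfl hGp'))
    linarith [(abs_le.mp (hclose _ hE)).2]
  · rcases lt_abs.mp (not_le.mp hE) with hE | hE
    · have h1 : P'.real Set.univ ≤ P'.real {ω | μ' ω ≤ E} + p := by
        refine (measureReal_mono (s₂ := {ω | μ' ω ≤ E} ∪ G'ᶜ) fun ω _ => ?_).trans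
          ((measureReal_union_le _ _).trans (add_le_add le_rfl hGp'))
        by_cases hωG : ω ∈ G'
        · left
          have := (abs_le.mp (hG' ω hωG).1).2
          change μ' ω ≤ E
          linarith
        · exact Or.inr hωG
      rw [probReal_univ] at h1
      linarith [measureReal_le_one (μ := P) (s := {ω | μ ω ≤ E - 2 * l})]
    · have h1 : P.real {ω | μ ω ≤ E - 2 * l} ≤ p := by
        refine (measureReal_mono fun ω hω hωG => ?_).trans hGp
        have h2 : μ ω ≤ E - 2 * l := hω
        have := (abs_le.mp (hG ω hωG).1).1
        linarith
      linarith

/-! ### The scales of the edge regime -/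

/-- Powers of the control parameter `φ` grow more slowly than any power of `N`. -/
theorem eventually_mpPhi_rpow_le (C : ℝ) {a : ℝ} (ha : 0 < a) :
    ∀ᶠ N : ℕ in atTop, mpPhi N ^ C ≤ (N : ℝ) ^ a := by
  have hloglog : Tendsto (fun N : ℕ => Real.log (Real.log N)) atTop atTop :=
    Real.tendsto_log_atTop.comp (Real.tendsto_log_atTop.comp tendsto_natCast_atTop_atTop)
  have hlog : Tendsto (fun N : ℕ => Real.log N) atTop atTop :=
    Real.tendsto_log_atTop.comp tendsto_natCast_atTop_atTop
  have hsq : Tendsto (fun x : ℝ => x ^ 2 * Real.exp (-x)) atTop (𝓝 0) :=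
    Real.tendsto_pow_mul_exp_neg_atTop_nhds_zero 2
  have hsmall := (((hsq.comp hloglog).const_mul C).eventually_le_const
    (show C * 0 < a by simpa using ha))
  filter_upwards [hsmall, hlog.eventually_gt_atTop 0, eventually_gt_atTop 0] with N h hl hN
  have hN' : (0 : ℝ) < N := by exact_mod_cast hN
  rw [mpPhi, Real.rpow_def_of_pos hl, ← Real.exp_mul, Real.rpow_def_of_pos hN', Real.exp_le_exp]
  simp only [Function.comp, Real.exp_neg, Real.exp_log hl] at h
  field_simp at h
  linarith

/-- Events of `1`-high probability have complements of probability at most `1 / N`. -/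
theorem HighProb.eventually_le_inv {Ω : ℕ → Type*} [∀ N, MeasurableSpace (Ω N)]
    {P : ∀ N, Measure (Ω N)} {A : ∀ N, Set (Ω N)} (h : HighProb P 1 A) :
    ∀ᶠ N : ℕ in atTop, (P N).real (A N)ᶜ ≤ (N : ℝ)⁻¹ := by
  obtain ⟨C, -, hC⟩ := h
  have hlog : Tendsto (fun N : ℕ => Real.log N) atTop atTop :=
    Real.tendsto_log_atTop.comp tendsto_natCast_atTop_atTop
  have hloglog : Tendsto (fun N : ℕ => Real.log (Real.log N)) atTop atTop :=
    Real.tendsto_log_atTop.comp hlog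
  filter_upwards [hC, hlog.eventually_ge_atTop (C + 1), hlog.eventually_ge_atTop 1,
    hloglog.eventually_ge_atTop 2, eventually_gt_atTop 0] with N h hl hl1 hll hN
  have hN' : (0 : ℝ) < N := by exact_mod_cast hN
  refine h.trans ?_
  have h1 : Real.log N ^ 2 ≤ mpPhi N := by
    rw [mpPhi, ← Real.rpow_natCast]
    exact Real.rpow_le_rpow_of_exponent_le hl1 (by simpa using hll)
  rw [Real.rpow_one, Real.rpow_def_of_pos hN', ← Real.exp_add, ← Real.exp_log (inv_pos.mpr hN'),
    Real.exp_le_exp, Real.log_inv]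
  nlinarith

theorem eventually_le_rpow {a : ℝ} (ha : 0 < a) (B : ℝ) :
    ∀ᶠ N : ℕ in atTop, B ≤ (N : ℝ) ^ a :=
  ((tendsto_rpow_atTop ha).comp tendsto_natCast_atTop_atTop).eventually_ge_atTop B

theorem eventually_rpow_neg_le {a b : ℝ} (ha : 0 < a) (hb : 0 < b) :
    ∀ᶠ N : ℕ in atTop, (N : ℝ) ^ (-a) ≤ b :=
  ((tendsto_rpow_neg_atTop ha).comp tendsto_natCast_atTop_atTop).eventually_le_const hb

theorem mul_rpow_edge_scale {N : ℕ} (hN : 0 < N) :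
    (N : ℝ) * ((N : ℝ) ^ (-(2 / 3) : ℝ) * Real.sqrt ((N : ℝ) ^ (-(2 / 3) : ℝ))) = 1 := by
  have hN' : (0 : ℝ) < N := by exact_mod_cast hN
  rw [Real.sqrt_eq_rpow, ← Real.rpow_mul hN'.le, ← Real.rpow_add hN',
    show (-(2 / 3) + -(2 / 3) * (1 / 2) : ℝ) = -1 by norm_num, Real.rpow_neg_one,
    mul_inv_cancel₀ hN'.ne']

theorem rpow_div_thirtytwo_pow {N : ℕ} (ε : ℝ) (k : ℕ) :
    ((N : ℝ) ^ (ε / 32)) ^ k = (N : ℝ) ^ (k * ε / 32) := by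
  rw [← Real.rpow_mul_natCast (Nat.cast_nonneg N)]
  congr 1
  ring

/-! ### Consequences of the strong local law near an edge -/

theorem mem_mpDomain_of_near_edge {N : ℕ} {d a e c₀ y s : ℝ} (hd : 0 < d) (he : IsMPEdge d e)
    (hc₀ : 0 < c₀) (hce : c₀ ≤ e) (hy : |y - e| ≤ c₀ / 2) (hy1 : |y - e| ≤ 1)
    (hs : mpPhi N ^ a * (N : ℝ)⁻¹ ≤ s) (hs1 : s ≤ 1) :
    (y : ℂ) + (s : ℂ) * Complex.I ∈ mpDomain N d a := by
  have h1 := he.lower_le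
  have h2 := he.le_upper
  have h3 : 1 ≤ mpUpper d := by
    unfold mpUpper
    exact one_le_pow₀ (by linarith [Real.sqrt_nonneg d])
  have h4 : 0 ≤ mpLower d := sq_nonneg _
  have h5 := abs_le.mp hy
  have h6 := abs_le.mp hy1
  refine ⟨?_, ?_, ?_, ?_⟩
  · simp only [Complex.add_re, Complex.ofReal_re, Complex.mul_re, Complex.I_re, Complex.I_im,
      Complex.ofReal_im]
    split_ifs <;> linarith
  · simp only [Complex.add_re, Complex.ofReal_re, Complex.mul_re, Complex.I_re, Complex.I_im,
      Complex.ofReal_im]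
    linarith
  · simpa using hs
  · have : s ≤ 10 * (1 + d) := by linarith
    simpa using this

/-- With probability at least `1 - 2 / N`, a matrix obeying the strong local law satisfies the
square-root bounds at an edge that stays away from `0`, and its spectrum does not spill out of the
bulk by more than `N ^ (-2/3 + ε/16)`. -/
theorem StrongLocalMP.eventually_edgeBounds {Ω : ℕ → Type*} [∀ N, MeasurableSpace (Ω N)]
    {P : ∀ N, Measure (Ω N)} [∀ N, IsProbabilityMeasure (P N)] {M : ℕ → ℕ}
    {X : ∀ N, Ω N → Matrix (Fin (M N)) (Fin N) ℂ} (h : StrongLocalMP P M X)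
    {d : ℝ} (hd : 0 < d) (hM : Tendsto (fun N : ℕ => (N : ℝ) / M N) atTop (𝓝 d))
    {e : ℕ → ℝ} (he : ∀ N : ℕ, IsMPEdge ((N : ℝ) / M N) (e N)) {c₀ : ℝ} (hc₀ : 0 < c₀)
    (hce : ∀ᶠ N in atTop, c₀ ≤ e N) :
    ∃ c : ℝ, 0 < c ∧ ∃ C : ℝ, 0 < C ∧ ∀ ε : ℝ, 0 < ε → ε ≤ 1 → ∀ᶠ N : ℕ in atTop,
      ∃ G : Set (Ω N), (P N).real Gᶜ ≤ 2 * (N : ℝ)⁻¹ ∧ ∀ ω ∈ G,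
        EdgeBounds (X N ω) (e N) ((N : ℝ) ^ (-(2 / 3) : ℝ)) ((N : ℝ) ^ (ε / 32)) c C ∧
        (∀ j < min (M N) N, mpLower ((N : ℝ) / M N)
          - (N : ℝ) ^ (-(2 / 3) : ℝ) * ((N : ℝ) ^ (ε / 32)) ^ 2 ≤ covEig (X N ω) j) ∧
        (∀ j < N, covEig (X N ω) j ≤ mpUpper ((N : ℝ) / M N)
          + (N : ℝ) ^ (-(2 / 3) : ℝ) * ((N : ℝ) ^ (ε / 32)) ^ 2) := by
  obtain ⟨a, -, hlaw, -, hext⟩ := h 1 one_pos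
  have hd1 : 0 < d / 2 := by linarith
  have hd2 : 0 < 2 * d := by linarith
  obtain ⟨C, hC, hup⟩ := im_mpStieltjes_le hd1 hd2 hc₀
  obtain ⟨c, hc, r, hr, hlow⟩ := le_im_mpStieltjes hd1 hd2 hc₀
  refine ⟨c, hc, C, hC, fun ε hε hε1 => ?_⟩
  have hr' : 0 < min r (min (c₀ / 2) 1) / 4 := by positivity
  filter_upwards [hlaw.eventually_le_inv, hext.eventually_le_inv, hce, eventually_gt_atTop 0,
    eventually_mpPhi_rpow_le a (show 0 < ε / 16 by positivity),
    hM.eventually_const_le (show d / 2 < d by linarith),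
    hM.eventually_le_const (show d < 2 * d by linarith),
    eventually_rpow_neg_le (show 0 < 2 / 3 - ε / 8 by linarith) hr',
    eventually_le_rpow (show 0 < ε / 32 by positivity) 1]
    with N hA hB hceN hN hφ hdl hdu hsmall hu1
  have hN' : (0 : ℝ) < N := by exact_mod_cast hN
  set q : ℝ := (N : ℝ) ^ (-(2 / 3) : ℝ) with hq
  set u : ℝ := (N : ℝ) ^ (ε / 32) with hu
  have hq0 : 0 < q := Real.rpow_pos_of_pos hN' _
  have hu0 : 0 < u := Real.rpow_pos_of_pos hN' _
  have hφu : mpPhi N ^ a ≤ u ^ 2 := by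
    rw [hu, rpow_div_thirtytwo_pow]
    convert hφ using 2
    push_cast; ring
  have hqu : q * u ^ 4 = (N : ℝ) ^ (-(2 / 3 - ε / 8)) := by
    rw [hu, rpow_div_thirtytwo_pow, hq, ← Real.rpow_add hN']
    congr 1; push_cast; ring
  have hqu_small : 4 * (q * u ^ 4) ≤ min r (min (c₀ / 2) 1) := by rw [hqu]; linarith
  have hqr : 4 * (q * u ^ 4) ≤ r := hqu_small.trans (min_le_left _ _)
  have hqc : 4 * (q * u ^ 4) ≤ c₀ / 2 :=
    hqu_small.trans ((min_le_right _ _).trans (min_le_left _ _))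
  have hq1 : 4 * (q * u ^ 4) ≤ 1 :=
    hqu_small.trans ((min_le_right _ _).trans (min_le_right _ _))
  have hdomain : mpPhi N ^ a * (N : ℝ)⁻¹ ≤ q / u ^ 4 := by
    rw [le_div_iff₀ (by positivity)]
    calc mpPhi N ^ a * (N : ℝ)⁻¹ * u ^ 4 ≤ u ^ 2 * (N : ℝ)⁻¹ * u ^ 4 := by gcongr
      _ = u ^ 6 * (N : ℝ)⁻¹ := by ring
      _ ≤ q := by
          rw [hu, rpow_div_thirtytwo_pow, hq, ← Real.rpow_neg_one, ← Real.rpow_add hN']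
          refine Real.rpow_le_rpow_of_exponent_le (by exact_mod_cast hN) ?_
          push_cast; linarith
  have hφq : q * mpPhi N ^ a ≤ q * u ^ 2 := by gcongr
  have hd0 : 0 < (N : ℝ) / M N := hd1.trans_le hdl
  have hprob := (measureReal_union_le _ _).trans (add_le_add hA hB)
  rw [← Set.compl_inter, ← two_mul] at hprob
  refine ⟨_, hprob, fun ω hω => ⟨?_, fun j hj => ?_, fun j hj => ?_⟩⟩
  rotate_left
  · exact le_trans (by linarith) (hω.2.1 j hj)
  · exact (hω.2.2 j hj).trans (by linarith)
  · -- the local law, multiplied by `N`, at a point close to the edge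
    have key : ∀ y s : ℝ, |y - e N| ≤ 3 * (q * u ^ 4) → q / u ^ 4 ≤ s → s ≤ q * u ^ 4 →
        |(N : ℝ) * (empStieltjes (X N ω) ((y : ℂ) + (s : ℂ) * Complex.I)).im
          - N * (mpStieltjes ((N : ℝ) / M N) ((y : ℂ) + (s : ℂ) * Complex.I)).im|
          ≤ u ^ 2 / s := by
      intro y s hy hs hs'
      have hs0 : 0 < s := lt_of_lt_of_le (by positivity) hs
      have hmem : (y : ℂ) + (s : ℂ) * Complex.I ∈ mpDomain N ((N : ℝ) / M N) a :=
        mem_mpDomain_of_near_edge hd0 (he N) hc₀ hceN (by linarith) (by linarith)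
          (hdomain.trans hs) (by linarith)
      have h1 := hω.1 _ hmem
      unfold mpLambda at h1
      have h2 : ((y : ℂ) + (s : ℂ) * Complex.I).im = s := by simp
      rw [h2] at h1
      rw [← mul_sub, ← Complex.sub_im, abs_mul, abs_of_pos hN']
      calc (N : ℝ) * |(empStieltjes (X N ω) ((y : ℂ) + (s : ℂ) * Complex.I)
              - mpStieltjes ((N : ℝ) / M N) ((y : ℂ) + (s : ℂ) * Complex.I)).im|
          ≤ N * (mpPhi N ^ a * (1 / (N * s))) := by
            gcongr
            exact (Complex.abs_im_le_norm _).trans h1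
        _ ≤ N * (u ^ 2 * (1 / (N * s))) := by gcongr
        _ = u ^ 2 / s := by field_simp
    refine ⟨fun y s hy hs hs' => ?_, fun s hs hs' => ?_⟩
    · have hs0 : 0 < s := lt_of_lt_of_le (by positivity) hs
      have h1 := (abs_le.mp (key y s hy hs hs')).2
      have h2 := mul_le_mul_of_nonneg_left
        (hup _ _ hdl hdu (he N) hceN y s (by linarith) hs0 (by linarith)) hN'.le
      linarith
    · have hs0 : 0 < s := lt_of_lt_of_le (by positivity) hs
      have h1 := (abs_le.mp (key (e N) s (by rw [sub_self, abs_zero]; positivity) hs hs')).1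
      have h2 := mul_le_mul_of_nonneg_left
        (hlow _ _ hdl hdu (he N) hceN s hs0 (by linarith)) hN'.le
      linarith

/-! ### Comparison of the edge eigenvalues -/

/-- A smooth cutoff that tells counts at most `1 / 2` from counts at least `1`. -/
theorem exists_count_cutoff : ∃ F : ℝ → ℝ, ContDiff ℝ 4 F ∧ (∀ x, F x ∈ Set.Icc (0 : ℝ) 1) ∧
    (∀ x, 0 ≤ x → x ≤ 1 / 2 → F x = 1) ∧ (∀ x, 1 ≤ x → F x = 0) ∧
    ∃ B : ℝ, 0 < B ∧ ∀ α : ℕ, 1 ≤ α → α ≤ 4 → ∀ x, |iteratedDeriv α F x| ≤ B := by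
  let f : ContDiffBump (0 : ℝ) := ⟨1 / 2, 1, by norm_num, by norm_num⟩
  have hf : ContDiff ℝ 4 f := f.contDiff
  have hbound : ∀ α : ℕ, α ≤ 4 → ∃ B, ∀ x, ‖iteratedFDeriv ℝ α f x‖ ≤ B := fun α hα =>
    (f.hasCompactSupport.iteratedFDeriv α).exists_bound_of_continuous
      (hf.continuous_iteratedFDeriv (by exact_mod_cast hα))
  refine ⟨f, hf, fun x => ⟨f.nonneg, f.le_one⟩, fun x hx hx' => ?_, fun x hx => ?_, ?_⟩
  · refine f.one_of_mem_closedBall ?_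
    rw [mem_closedBall_zero_iff, Real.norm_of_nonneg hx]
    exact hx'
  · refine f.zero_of_le_dist ?_
    rw [Real.dist_eq, sub_zero]
    exact hx.trans (le_abs_self x)
  · choose! B hB using hbound
    have hB0 : ∀ α, α ≤ 4 → 0 ≤ B α := fun α hα => (norm_nonneg _).trans (hB α hα 0)
    refine ⟨∑ α ∈ Finset.range 5, B α + 1, ?_, fun α _ hα x => ?_⟩
    · have := Finset.sum_nonneg (s := Finset.range 5) (f := B)
        fun α hα => hB0 α (by simp at hα; omega)
      linarith
    · rw [← Real.norm_eq_abs, ← norm_iteratedFDeriv_eq_norm_iteratedDeriv]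
      have := Finset.single_le_sum (s := Finset.range 5) (f := B)
        (fun α hα => hB0 α (by simp at hα; omega)) (a := α) (by simp; omega)
      linarith [hB α hα x]

/-- Edge universality for random variables that are located by a smooth function `F` of the smoothed
count over a window `[a N ε E, b N ε E]` close to the edge. -/
theorem GreenComparison.edgeUniversal {ΩY ΩZ : ℕ → Type*} [∀ N, MeasurableSpace (ΩY N)]
    [∀ N, MeasurableSpace (ΩZ N)] {PY : ∀ N, Measure (ΩY N)} {PZ : ∀ N, Measure (ΩZ N)}
    [∀ N, IsProbabilityMeasure (PY N)] [∀ N, IsProbabilityMeasure (PZ N)] {M : ℕ → ℕ}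
    {Y : ∀ N, ΩY N → Matrix (Fin (M N)) (Fin N) ℂ} {Z : ∀ N, ΩZ N → Matrix (Fin (M N)) (Fin N) ℂ}
    {e : ℕ → ℝ} (hgreen : GreenComparison PY PZ M Y Z e)
    (hYm : ∀ N i j, Measurable fun ω => Y N ω i j) (hZm : ∀ N i j, Measurable fun ω => Z N ω i j)
    {μY : ∀ N, ΩY N → ℝ} {μZ : ∀ N, ΩZ N → ℝ} {F : ℝ → ℝ} (hF : ContDiff ℝ 4 F)
    (hF01 : ∀ x, F x ∈ Set.Icc (0 : ℝ) 1) {B : ℝ} (hB : 0 < B)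
    (hFB : ∀ α : ℕ, 1 ≤ α → α ≤ 4 → ∀ x, |iteratedDeriv α F x| ≤ B) (a b : ℕ → ℝ → ℝ → ℝ)
    (hab : ∀ (N : ℕ) (ε E ρ : ℝ), ρ = (N : ℝ) ^ (-(2 / 3) : ℝ) * ((N : ℝ) ^ (ε / 32)) ^ 4 →
      |E - e N| ≤ 2 * ρ → |a N ε E - e N| ≤ 3 * ρ ∧ |b N ε E - e N| ≤ 3 * ρ)
    (hlocY : ∀ ε : ℝ, 0 < ε → ε ≤ 1 → ∀ᶠ N : ℕ in atTop, Locates (PY N) (μY N) (e N)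
      ((N : ℝ) ^ (-(2 / 3) : ℝ) * ((N : ℝ) ^ (ε / 32)) ^ 4)
      ((N : ℝ) ^ (-(2 / 3) : ℝ) / ((N : ℝ) ^ (ε / 32)) ^ 4) (2 * (N : ℝ)⁻¹)
      fun E ω => F (smoothCount (Y N ω) ((N : ℝ) ^ (-(2 / 3) : ℝ) / ((N : ℝ) ^ (ε / 32)) ^ 32)
        (a N ε E) (b N ε E)))
    (hlocZ : ∀ ε : ℝ, 0 < ε → ε ≤ 1 → ∀ᶠ N : ℕ in atTop, Locates (PZ N) (μZ N) (e N)
      ((N : ℝ) ^ (-(2 / 3) : ℝ) * ((N : ℝ) ^ (ε / 32)) ^ 4)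
      ((N : ℝ) ^ (-(2 / 3) : ℝ) / ((N : ℝ) ^ (ε / 32)) ^ 4) (2 * (N : ℝ)⁻¹)
      fun E ω => F (smoothCount (Z N ω) ((N : ℝ) ^ (-(2 / 3) : ℝ) / ((N : ℝ) ^ (ε / 32)) ^ 32)
        (a N ε E) (b N ε E))) :
    EdgeUniversal PY PZ μY μZ e := by
  obtain ⟨ε₀, hε₀, C, hC, hcomp⟩ := hgreen B hB
  -- `C ε ≤ 1 / 12`, so that the comparison error is at most `C N ^ (-1/12)`
  set ε : ℝ := min (ε₀ / 2) (min 1 (1 / (12 * C))) with hεdef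
  have hε : 0 < ε := by positivity
  have hεε₀ : ε < ε₀ := (min_le_left _ _).trans_lt (by linarith)
  have hε1 : ε ≤ 1 := (min_le_right _ _).trans (min_le_left _ _)
  have hεC : C * ε ≤ 1 / 12 := by
    have : ε ≤ 1 / (12 * C) := (min_le_right _ _).trans (min_le_right _ _)
    calc C * ε ≤ C * (1 / (12 * C)) := by gcongr
      _ = 1 / 12 := by field_simp
  obtain ⟨N₀, hN₀⟩ := hcomp ε hε hεε₀
  refine ⟨ε / 16, by positivity, 1 / 24, by norm_num, ?_⟩
  refine eventually_atTop.mp ?_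
  filter_upwards [hlocY ε hε hε1, hlocZ ε hε hε1, eventually_ge_atTop N₀, eventually_gt_atTop 0,
    eventually_le_rpow (show 0 < ε / 32 by positivity) 3,
    eventually_le_rpow (show (0 : ℝ) < 1 / 24 by norm_num) (4 + C)]
    with N hY hZ hNN₀ hN hu3 herr s
  have hN' : (0 : ℝ) < N := by exact_mod_cast hN
  have hN1 : (1 : ℝ) ≤ N := by exact_mod_cast hN
  have hηeq : (N : ℝ) ^ (-(2 / 3) : ℝ) / ((N : ℝ) ^ (ε / 32)) ^ 32
      = (N : ℝ) ^ (-(2 / 3) - ε : ℝ) := by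
    rw [rpow_div_thirtytwo_pow, ← Real.rpow_sub hN']
    congr 1; push_cast; ring
  have hwide : (N : ℝ) ^ (-(2 / 3) : ℝ) * ((N : ℝ) ^ (ε / 32)) ^ 32
      = (N : ℝ) ^ (-(2 / 3) + ε : ℝ) := by
    rw [rpow_div_thirtytwo_pow, ← Real.rpow_add hN']
    congr 1; push_cast; ring
  have hshift : (N : ℝ) ^ (-(ε / 16)) = 1 / ((N : ℝ) ^ (ε / 32)) ^ 2 := by
    rw [rpow_div_thirtytwo_pow, Real.rpow_neg hN'.le, one_div]
    congr 2; push_cast; ring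
  have hq23 : (N : ℝ) ^ (2 / 3 : ℝ) = ((N : ℝ) ^ (-(2 / 3) : ℝ))⁻¹ := by
    rw [Real.rpow_neg hN'.le, inv_inv]
  have hab' := fun E => hab N ε E _ rfl
  rw [hshift, hq23]
  set q : ℝ := (N : ℝ) ^ (-(2 / 3) : ℝ) with hq
  set u : ℝ := (N : ℝ) ^ (ε / 32) with hu
  have hq0 : 0 < q := Real.rpow_pos_of_pos hN' _
  have hu0 : 0 < u := by linarith
  have hu1 : 1 ≤ u := by linarith
  have hκ : 0 ≤ C * (N : ℝ) ^ (-(1 / 6) + C * ε : ℝ) := by positivity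
  have h3ρ : 3 * (q * u ^ 4) ≤ (N : ℝ) ^ (-(2 / 3) + ε : ℝ) := by
    rw [← hwide]
    have : 3 ≤ u ^ 28 := hu3.trans (le_self_pow₀ hu1 (by norm_num))
    calc 3 * (q * u ^ 4) ≤ u ^ 28 * (q * u ^ 4) := by gcongr
      _ = q * u ^ 32 := by ring
  have hclose : ∀ E, |E - e N| ≤ 2 * (q * u ^ 4) →
      |(∫ ω, F (smoothCount (Y N ω) (q / u ^ 32) (a N ε E) (b N ε E)) ∂(PY N))
        - ∫ ω, F (smoothCount (Z N ω) (q / u ^ 32) (a N ε E) (b N ε E)) ∂(PZ N)|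
      ≤ C * (N : ℝ) ^ (-(1 / 6) + C * ε : ℝ) := by
    intro E hE
    have hrange := hab' E hE
    refine (hN₀ N hNN₀ F hF ?_ _ hηeq (e N) _ _ ?_ (hrange.1.trans h3ρ)
      (hrange.2.trans h3ρ)).2
    · intro α hα hα' x
      have h1 : (|x| + 1) ^ (-B) ≤ 1 :=
        Real.rpow_le_one_of_one_le_of_nonpos (by linarith [abs_nonneg x]) (by linarith)
      calc |iteratedDeriv α F x| * (|x| + 1) ^ (-B) ≤ B * 1 := by
            gcongr
            exact hFB α hα hα' x
        _ = B := mul_one B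
    · rw [sub_self, abs_zero]; positivity
  have hmeasY : ∀ E, Measurable fun ω =>
      F (smoothCount (Y N ω) (q / u ^ 32) (a N ε E) (b N ε E)) := fun E =>
    hF.continuous.measurable.comp (measurable_smoothCount (hYm N) _ _ _)
  have hmeasZ : ∀ E, Measurable fun ω =>
      F (smoothCount (Z N ω) (q / u ^ 32) (a N ε E) (b N ε E)) := fun E =>
    hF.continuous.measurable.comp (measurable_smoothCount (hZm N) _ _ _)
  have herr' : 2 * (2 * (N : ℝ)⁻¹) + C * (N : ℝ) ^ (-(1 / 6) + C * ε : ℝ)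
      ≤ (N : ℝ) ^ (-(1 / 24) : ℝ) := by
    have h1 : (N : ℝ)⁻¹ ≤ (N : ℝ) ^ (-(1 / 12) : ℝ) := by
      rw [← Real.rpow_neg_one]
      exact Real.rpow_le_rpow_of_exponent_le hN1 (by norm_num)
    have h2 : (N : ℝ) ^ (-(1 / 6) + C * ε : ℝ) ≤ (N : ℝ) ^ (-(1 / 12) : ℝ) :=
      Real.rpow_le_rpow_of_exponent_le hN1 (by linarith)
    calc 2 * (2 * (N : ℝ)⁻¹) + C * (N : ℝ) ^ (-(1 / 6) + C * ε : ℝ)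
        ≤ 2 * (2 * (N : ℝ) ^ (-(1 / 12) : ℝ)) + C * (N : ℝ) ^ (-(1 / 12) : ℝ) := by gcongr
      _ = (4 + C) * (N : ℝ) ^ (-(1 / 12) : ℝ) := by ring
      _ ≤ (N : ℝ) ^ (1 / 24 : ℝ) * (N : ℝ) ^ (-(1 / 12) : ℝ) := by gcongr
      _ = (N : ℝ) ^ (-(1 / 24) : ℝ) := by
          rw [← Real.rpow_add hN']; norm_num
  have h2l : 2 * (q / u ^ 4) ≤ q * (1 / u ^ 2) := by
    have : 2 ≤ u ^ 2 := by nlinarith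
    calc 2 * (q / u ^ 4) ≤ u ^ 2 * (q / u ^ 4) := by gcongr
      _ = q * (1 / u ^ 2) := by field_simp
  have hev : ∀ x t : ℝ, q⁻¹ * (x - e N) ≤ t ↔ x ≤ e N + q * t := by
    intro x t
    rw [inv_mul_le_iff₀ hq0, sub_le_iff_le_add']
  simp only [hev]
  have hYZ := hY.cdf_le hZ hmeasY hmeasZ (fun _ _ => hF01 _) (fun _ _ => hF01 _)
    (by positivity) (by positivity) hκ hclose (e N + q * s)
  have hZY := hZ.cdf_le hY hmeasZ hmeasY (fun _ _ => hF01 _) (fun _ _ => hF01 _)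
    (by positivity) (by positivity) hκ (fun E hE => by rw [abs_sub_comm]; exact hclose E hE)
    (e N + q * s + 2 * (q / u ^ 4))
  constructor
  · have hsub : (PY N).real {ω | μY N ω ≤ e N + q * (s - 1 / u ^ 2)}
        ≤ (PY N).real {ω | μY N ω ≤ e N + q * s - 2 * (q / u ^ 4)} :=
      measureReal_mono fun ω hω => by
        have hω' : μY N ω ≤ e N + q * (s - 1 / u ^ 2) := hω
        change μY N ω ≤ e N + q * s - 2 * (q / u ^ 4)
        linarith
    linarith
  · have hsub : (PY N).real {ω | μY N ω ≤ e N + q * s + 2 * (q / u ^ 4)}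
        ≤ (PY N).real {ω | μY N ω ≤ e N + q * (s + 1 / u ^ 2)} :=
      measureReal_mono fun ω hω => by
        have hω' : μY N ω ≤ e N + q * s + 2 * (q / u ^ 4) := hω
        change μY N ω ≤ e N + q * (s + 1 / u ^ 2)
        linarith
    rw [add_sub_cancel_right] at hZY
    linarith

/-- All largeness conditions of the deterministic lemmas hold for `u = N ^ (ε/32)` eventually. -/
theorem eventually_edge_scale_large {c C ε : ℝ} (hc : 0 < c) (hε : 0 < ε) :
    ∀ᶠ N : ℕ in atTop, 1 ≤ (N : ℝ) ^ (ε / 32) ∧ 24 * (2 * C + 1) ≤ (N : ℝ) ^ (ε / 32) ∧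
      2 * C + 3 < c * (N : ℝ) ^ (ε / 32) := by
  have h32 : 0 < ε / 32 := by positivity
  filter_upwards [eventually_le_rpow h32 1, eventually_le_rpow h32 (24 * (2 * C + 1)),
    eventually_le_rpow h32 ((2 * C + 4) / c)] with N h1 h2 h3
  refine ⟨h1, h2, ?_⟩
  rw [div_le_iff₀' hc] at h3
  linarith

theorem StrongLocalMP.eventually_locates_largest {Ω : ℕ → Type*} [∀ N, MeasurableSpace (Ω N)]
    {P : ∀ N, Measure (Ω N)} [∀ N, IsProbabilityMeasure (P N)] {M : ℕ → ℕ}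
    {X : ∀ N, Ω N → Matrix (Fin (M N)) (Fin N) ℂ} (h : StrongLocalMP P M X)
    {d : ℝ} (hd : 0 < d) (hM : Tendsto (fun N : ℕ => (N : ℝ) / M N) atTop (𝓝 d))
    {F : ℝ → ℝ} (hF1 : ∀ x, 0 ≤ x → x ≤ 1 / 2 → F x = 1) (hF0 : ∀ x, 1 ≤ x → F x = 0)
    (ε : ℝ) (hε : 0 < ε) (hε1 : ε ≤ 1) :
    ∀ᶠ N : ℕ in atTop, Locates (P N) (fun ω => covEig (X N ω) 0) (mpUpper ((N : ℝ) / M N))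
      ((N : ℝ) ^ (-(2 / 3) : ℝ) * ((N : ℝ) ^ (ε / 32)) ^ 4)
      ((N : ℝ) ^ (-(2 / 3) : ℝ) / ((N : ℝ) ^ (ε / 32)) ^ 4) (2 * (N : ℝ)⁻¹)
      fun E ω => F (smoothCount (X N ω) ((N : ℝ) ^ (-(2 / 3) : ℝ) / ((N : ℝ) ^ (ε / 32)) ^ 32)
        E (mpUpper ((N : ℝ) / M N)
          + 3 * ((N : ℝ) ^ (-(2 / 3) : ℝ) * ((N : ℝ) ^ (ε / 32)) ^ 4))) := by
  have hone : ∀ x : ℝ, 1 ≤ mpUpper x := fun x =>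
    one_le_pow₀ (by linarith [Real.sqrt_nonneg x])
  obtain ⟨c, hc, C, hC, hev⟩ := h.eventually_edgeBounds hd hM
    (e := fun N => mpUpper ((N : ℝ) / M N)) (fun N => Or.inl rfl) one_pos
    (Eventually.of_forall fun N => hone _)
  filter_upwards [hev ε hε hε1, eventually_edge_scale_large (C := C) hc hε,
    eventually_gt_atTop 0] with N ⟨G, hGp, hG⟩ ⟨hu, hlarge, hlarge'⟩ hN
  have hN' : (0 : ℝ) < N := by exact_mod_cast hN
  refine ⟨G, hGp, fun ω hω => ?_⟩
  obtain ⟨hb, -, hmax⟩ := hG ω hω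
  obtain ⟨h1, h2⟩ := hb.locate_largest hC (Real.rpow_pos_of_pos hN' _) hu
    (mul_rpow_edge_scale hN) hlarge hlarge' hmax
  refine ⟨h1, fun E hE => ⟨fun hμ => hF1 _ ?_ ((h2 E hE).1 hμ), fun hμ => hF0 _ ((h2 E hE).2 hμ)⟩⟩
  have hρ : 0 < (N : ℝ) ^ (-(2 / 3) : ℝ) * ((N : ℝ) ^ (ε / 32)) ^ 4 := by positivity
  exact smoothCount_nonneg _ (by positivity) (by linarith [(abs_le.mp hE).2])

theorem StrongLocalMP.eventually_locates_smallest {Ω : ℕ → Type*} [∀ N, MeasurableSpace (Ω N)]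
    {P : ∀ N, Measure (Ω N)} [∀ N, IsProbabilityMeasure (P N)] {M : ℕ → ℕ}
    {X : ∀ N, Ω N → Matrix (Fin (M N)) (Fin N) ℂ} (h : StrongLocalMP P M X)
    {d : ℝ} (hd : 0 < d) (hd1 : d ≠ 1) (hM : Tendsto (fun N : ℕ => (N : ℝ) / M N) atTop (𝓝 d))
    {F : ℝ → ℝ} (hF0 : ∀ x, 0 ≤ x → x ≤ 1 / 2 → F x = 0) (hF1 : ∀ x, 1 ≤ x → F x = 1)
    (ε : ℝ) (hε : 0 < ε) (hε1 : ε ≤ 1) :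
    ∀ᶠ N : ℕ in atTop, Locates (P N) (fun ω => covEig (X N ω) (min (M N) N - 1))
      (mpLower ((N : ℝ) / M N))
      ((N : ℝ) ^ (-(2 / 3) : ℝ) * ((N : ℝ) ^ (ε / 32)) ^ 4)
      ((N : ℝ) ^ (-(2 / 3) : ℝ) / ((N : ℝ) ^ (ε / 32)) ^ 4) (2 * (N : ℝ)⁻¹)
      fun E ω => F (smoothCount (X N ω) ((N : ℝ) ^ (-(2 / 3) : ℝ) / ((N : ℝ) ^ (ε / 32)) ^ 32)
        (mpLower ((N : ℝ) / M N)
          - 3 * ((N : ℝ) ^ (-(2 / 3) : ℝ) * ((N : ℝ) ^ (ε / 32)) ^ 4)) E) := by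
  -- `d ≠ 1` keeps the lower edge away from the hard edge `0`
  have hpos : 0 < mpLower d := by
    have h1 : Real.sqrt d ≠ 1 := fun h => hd1 (by rwa [Real.sqrt_eq_one] at h)
    exact sq_pos_of_ne_zero (sub_ne_zero.mpr h1.symm)
  have hlim : Tendsto (fun N : ℕ => mpLower ((N : ℝ) / M N)) atTop (𝓝 (mpLower d)) := by
    have hcont : Continuous mpLower := by unfold mpLower; fun_prop
    exact (hcont.tendsto d).comp hM
  have hc₀ : ∀ᶠ N : ℕ in atTop, mpLower d / 2 ≤ mpLower ((N : ℝ) / M N) :=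
    hlim.eventually_const_le (by linarith)
  obtain ⟨c, hc, C, hC, hev⟩ := h.eventually_edgeBounds hd hM
    (e := fun N => mpLower ((N : ℝ) / M N)) (fun N => Or.inr rfl) (half_pos hpos) hc₀
  filter_upwards [hev ε hε hε1, eventually_edge_scale_large (C := C) hc hε,
    eventually_gt_atTop 0, hc₀,
    eventually_rpow_neg_le (show 0 < 2 / 3 - ε / 8 by linarith) (show 0 < mpLower d / 8 by linarith)]
    with N ⟨G, hGp, hG⟩ ⟨hu, hlarge, hlarge'⟩ hN hcN hsmall
  have hN' : (0 : ℝ) < N := by exact_mod_cast hN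
  have hρeq : (N : ℝ) ^ (-(2 / 3) : ℝ) * ((N : ℝ) ^ (ε / 32)) ^ 4
      = (N : ℝ) ^ (-(2 / 3 - ε / 8)) := by
    rw [rpow_div_thirtytwo_pow, ← Real.rpow_add hN']
    congr 1; push_cast; ring
  refine ⟨G, hGp, fun ω hω => ?_⟩
  obtain ⟨hb, hmin, -⟩ := hG ω hω
  obtain ⟨h1, h2⟩ := hb.locate_smallest hC (Real.rpow_pos_of_pos hN' _) hu
    (mul_rpow_edge_scale hN) hlarge hlarge' (by rw [hρeq]; linarith) hmin
  refine ⟨h1, fun E hE => ⟨fun hμ => hF1 _ ((h2 E hE).1 hμ), fun hμ => hF0 _ ?_ ((h2 E hE).2 hμ)⟩⟩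
  have hρ : 0 < (N : ℝ) ^ (-(2 / 3) : ℝ) * ((N : ℝ) ^ (ε / 32)) ^ 4 := by positivity
  exact smoothCount_nonneg _ (by positivity) (by linarith [(abs_le.mp hE).1])

theorem theorem4p5 {ΩY ΩZ : ℕ → Type*}
    [∀ N, MeasurableSpace (ΩY N)] [∀ N, MeasurableSpace (ΩZ N)]
    (PY : ∀ N, Measure (ΩY N)) (PZ : ∀ N, Measure (ΩZ N))
    [∀ N, IsProbabilityMeasure (PY N)] [∀ N, IsProbabilityMeasure (PZ N)]
    (M : ℕ → ℕ) (d : ℝ) (hd : 0 < d)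
    (hM : Tendsto (fun N : ℕ => (N : ℝ) / M N) atTop (𝓝 d))
    (Y : ∀ N, ΩY N → Matrix (Fin (M N)) (Fin N) ℂ)
    (Z : ∀ N, ΩZ N → Matrix (Fin (M N)) (Fin N) ℂ)
    (hYm : ∀ N i j, Measurable fun ω => Y N ω i j)
    (hZm : ∀ N i j, Measurable fun ω => Z N ω i j)
    (hY : StrongLocalMP PY M Y) (hZ : StrongLocalMP PZ M Z) :
    (GreenComparison PY PZ M Y Z (fun N => mpUpper ((N : ℝ) / M N)) →
      MultiGreenComparison PY PZ M Y Z (fun N => mpUpper ((N : ℝ) / M N)) →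
      EdgeUniversal PY PZ (fun N ω => covEig (Y N ω) 0) (fun N ω => covEig (Z N ω) 0)
        (fun N => mpUpper ((N : ℝ) / M N))) ∧
    (d ≠ 1 →
      GreenComparison PY PZ M Y Z (fun N => mpLower ((N : ℝ) / M N)) →
      MultiGreenComparison PY PZ M Y Z (fun N => mpLower ((N : ℝ) / M N)) →
      EdgeUniversal PY PZ (fun N ω => covEig (Y N ω) (min (M N) N - 1))
        (fun N ω => covEig (Z N ω) (min (M N) N - 1))
        (fun N => mpLower ((N : ℝ) / M N))) := by
  obtain ⟨F, hF, hF01, hF1, hF0, B, hB, hFB⟩ := exists_count_cutoff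
  refine ⟨fun hgreen _ => ?_, fun hd1 hgreen _ => ?_⟩
  · refine hgreen.edgeUniversal hYm hZm hF hF01 hB hFB (fun _ _ E => E)
      (fun N ε _ => mpUpper ((N : ℝ) / M N)
        + 3 * ((N : ℝ) ^ (-(2 / 3) : ℝ) * ((N : ℝ) ^ (ε / 32)) ^ 4)) ?_
      (hY.eventually_locates_largest hd hM hF1 hF0) (hZ.eventually_locates_largest hd hM hF1 hF0)
    rintro N ε E ρ rfl hE
    have hρ := (abs_nonneg _).trans hE
    refine ⟨by linarith, ?_⟩
    rw [add_sub_cancel_left, abs_of_nonneg (by linarith)]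
  · -- the window lies below `E`, so a low count means a large eigenvalue: the test function is `1 - F`
    have hG0 : ∀ x, 0 ≤ x → x ≤ 1 / 2 → (fun x => 1 - F x) x = 0 := fun x hx hx' => by
      simp [hF1 x hx hx']
    have hG1 : ∀ x, 1 ≤ x → (fun x => 1 - F x) x = 1 := fun x hx => by simp [hF0 x hx]
    refine hgreen.edgeUniversal hYm hZm (F := fun x => 1 - F x) (contDiff_const.sub hF)
      (fun x => ⟨by linarith [(hF01 x).2], by linarith [(hF01 x).1]⟩) hB (fun α hα hα' x => ?_)
      (fun N ε _ => mpLower ((N : ℝ) / M N)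
        - 3 * ((N : ℝ) ^ (-(2 / 3) : ℝ) * ((N : ℝ) ^ (ε / 32)) ^ 4)) (fun _ _ E => E) ?_
      (hY.eventually_locates_smallest hd hd1 hM hG0 hG1)
      (hZ.eventually_locates_smallest hd hd1 hM hG0 hG1)
    · rw [iteratedDeriv_const_sub hα, iteratedDeriv_neg, abs_neg]
      exact hFB α hα hα' x
    · rintro N ε E ρ rfl hE
      have hρ := (abs_nonneg _).trans hE
      refine ⟨?_, by linarith⟩
      rw [sub_sub_cancel_left, abs_neg, abs_of_nonneg (by linarith)]
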